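/- **Setting.** Let $\Omega=B(0,1)\subset\mathbb R^2$ and $\Omega'=\,]-1,1[\,\times S^1$, where $S^1$ is identified with $[-\pi,\pi[$ through $\vartheta(\varphi)=(\cos\varphi,\sin\varphi)$; put $\vartheta(\varphi)^\perp=(-\sin\varphi,\cos\varphi)$. Functions on $\Omega$ are real-valued and extended by zero to $\mathbb R^2$. The Radon transform is the bounded linear operator $\mathcal R\colon L^2(\Omega)\to L^2(\Omega')$, $$[\mathcal R f](s,\varphi)=\int_{\mathbb R} f\bigl(s\,\vartheta(\varphi)+t\,\vartheta(\varphi)^\perp\bigr)\,dt .$$ A discretization consists of the following data. * Integers $P,Q,N,M\ge 1$ and widths $\delta_s,\delta_x>0$. * Offsets $s_p=\delta_s\bigl(p-\tfrac{P+1}2\bigr)$ and detector pixels $S_p=s_p+[-\delta_s/2,\delta_s/2[$ for $1\le p\le P$. * Angles $-\pi\le\varphi_1<\dots<\varphi_Q<\pi$, with $\varphi_0=\varphi_Q-2\pi$ and $\varphi_{Q+1}=\varphi_1+2\pi$; angular pixels $\Phi_q=\bigl[\tfrac{\varphi_{q-1}+\varphi_q}2,\tfrac{\varphi_q+\varphi_{q+1}}2\bigr[$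 modulo $2\pi$; and $\delta_\varphi=\max_{1\le q\le Q}(\varphi_{q+1}-\varphi_q)$. * Pixel centers $x_{ij}=\delta_x\bigl(i-\tfrac{N+1}2,\,j-\tfrac{M+1}2\bigr)$ and pixels $X_{ij}=x_{ij}+[-\delta_x/2,\delta_x/2[^2$ for $1\le i\le N$, $1\le j\le M$. It is assumed that $\Omega\subset\bigcup_{i,j}X_{ij}$ and $\Omega'\subset\bigcup_{p,q}S_p\times\Phi_q$. With $w_{\delta}(t)=\max(0,\delta-|t|)$ and $f_{ij}=\delta_x^{-2}\int_{X_{ij}}f(x)\,dx$, the fully discrete pixel-driven Radon transform $\mathcal R_{\delta_s,\delta_\varphi}^{\delta_x}\colon L^2(\Omega)\to L^2(\Omega')$ is $$[\mathcal R_{\delta_s,\delta_\varphi}^{\delta_x}f](s,\varphi)=\frac{\delta_x^2}{\delta_s^2}\sum_{p=1}^P\sum_{q=1}^Q\chi_{S_p}(s)\,\chi_{\Phi_q}(\varphi)\sum_{i=1}^N\sum_{j=1}^M w_{\delta_s}\bigl(x_{ij}\cdot\vartheta(\varphi_q)-s_p\bigr)f_{ij}.$$ **Theorem.** Consider any family of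 such discretizations along which (with respect to a given filter on the index set, for instance a sequence) $\delta_s\to0$. Let $\|\cdot\|$ denote the operator norm of bounded linear operators $L^2(\Omega)\to L^2(\Omega')$. 1. If $\delta_\varphi/\delta_s\to0$ and $\delta_x/\delta_s\to0$, then $\|\mathcal R_{\delta_s,\delta_\varphi}^{\delta_x}-\mathcal R\|\to0$. 2. If $\delta_\varphi=O(\delta_s^{1+\epsilon})$ and $\delta_x=O(\delta_s^{1+\epsilon})$ for some $0<\epsilon\le\frac12$, then $\|\mathcal R_{\delta_s,\delta_\varphi}^{\delta_x}-\mathcal R\|=O(\delta_s^{\epsilon})$. -/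

import Mathlib

noncomputable section

namespace PixelRadon

open MeasureTheory Set Filter Topology
open scoped Real ENNReal RealInnerProductSpace

/-- The Euclidean plane. -/
abbrev Plane : Type := EuclideanSpace ℝ (Fin 2)

/-- The image domain: the open unit ball of the plane. -/
def Ω : Set Plane := Metric.ball 0 1

/-- The sinogram domain `]-1,1[ × S¹`, where `S¹` is identified with `[-π,π[`. -/
def Ω' : Set (ℝ × ℝ) := Ioo (-1) 1 ×ˢ Ico (-π) π

/-- The real space `L²(Ω)` (Lebesgue measure). -/
abbrev L2Image : Type := Lp ℝ 2 (volume.restrict Ω : Measure Plane)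

/-- The real space `L²(Ω')` (arc length on `S¹` is Lebesgue measure on `[-π,π[`). -/
abbrev L2Sinogram : Type := Lp ℝ 2 (volume.restrict Ω' : Measure (ℝ × ℝ))

/-- The projection direction `ϑ(φ) = (cos φ, sin φ)`. -/
def dir (φ : ℝ) : Plane := !₂[Real.cos φ, Real.sin φ]

/-- The rotated direction `ϑ(φ)^⊥ = (-sin φ, cos φ)`. -/
def dirPerp (φ : ℝ) : Plane := !₂[-Real.sin φ, Real.cos φ]

/-- The Radon transform of a function on the plane: `z = (s, φ)` is sent to the integral of `f`
over the line `t ↦ s ϑ(φ) + t ϑ(φ)^⊥`. -/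
def radonFun (f : Plane → ℝ) (z : ℝ × ℝ) : ℝ :=
  ∫ t : ℝ, f (z.1 • dir z.2 + t • dirPerp z.2)

/-! Auxiliary facts: the Radon transform is a bounded operator `L²(Ω) → L²(Ω')`. -/

/-- The parametrization `((s, φ), t) ↦ s ϑ(φ) + t ϑ(φ)^⊥`. -/
def linePoint (w : (ℝ × ℝ) × ℝ) : Plane := w.1.1 • dir w.1.2 + w.2 • dirPerp w.1.2

lemma orthonormal_dir (φ : ℝ) : Orthonormal ℝ ![dir φ, dirPerp φ] := by
  have h := Real.sin_sq_add_cos_sq φ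
  rw [orthonormal_iff_ite]
  intro i j
  fin_cases i <;> fin_cases j <;>
    simp [dir, dirPerp, PiLp.inner_apply, Fin.sum_univ_two, EuclideanSpace.norm_eq] <;>
    nlinarith

lemma measurePreserving_line (φ : ℝ) :
    MeasurePreserving (fun p : ℝ × ℝ => p.1 • dir φ + p.2 • dirPerp φ) := by
  let b : OrthonormalBasis (Fin 2) ℝ Plane :=
    (basisOfOrthonormalOfCardEqFinrank (orthonormal_dir φ) (by simp)).toOrthonormalBasis
      (by simpa using orthonormal_dir φ)
  have h := (b.measurePreserving_repr_symm.comp (PiLp.volume_preserving_toLp (Fin 2))).comp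
    ((volume_preserving_finTwoArrow ℝ).symm _)
  convert! h using 1
  ext1 p
  simp [b, Fin.sum_univ_two]

lemma measurable_linePoint : Measurable linePoint := by
  have h : Continuous linePoint := by
    unfold linePoint dir dirPerp
    fun_prop
  exact h.measurable

lemma map_linePoint_le :
    ((volume.restrict Ω').prod (volume : Measure ℝ)).map linePoint
      ≤ ENNReal.ofReal (2 * π) • (volume : Measure Plane) := by
  refine Measure.le_iff.2 fun A hA => ?_
  have hm : Measurable fun w : (ℝ × ℝ) × ℝ => A.indicator (1 : Plane → ℝ≥0∞) (linePoint w) :=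
    (measurable_one.indicator hA).comp measurable_linePoint
  rw [← lintegral_indicator_one hA, lintegral_map (measurable_one.indicator hA)
    measurable_linePoint, lintegral_prod _ hm.aemeasurable]
  have hm2 : Measurable fun z : ℝ × ℝ =>
      ∫⁻ t : ℝ, A.indicator (1 : Plane → ℝ≥0∞) (linePoint (z, t)) := hm.lintegral_prod_right'
  rw [Ω', Measure.volume_eq_prod, ← Measure.prod_restrict,
    lintegral_prod_symm _ hm2.aemeasurable]
  calc _ ≤ ∫⁻ _φ in Ico (-π) π, volume A := by
        refine lintegral_mono fun φ => ?_
        refine (setLIntegral_le_lintegral _ _).trans ?_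
        have hmφ : Measurable fun p : ℝ × ℝ =>
            A.indicator (1 : Plane → ℝ≥0∞) (p.1 • dir φ + p.2 • dirPerp φ) :=
          (measurable_one.indicator hA).comp (measurePreserving_line φ).measurable
        have := (measurePreserving_line φ).lintegral_comp (measurable_one.indicator hA)
        rw [Measure.volume_eq_prod, lintegral_prod _ hmφ.aemeasurable,
          lintegral_indicator_one hA] at this
        exact this.le
    _ = _ := by
        rw [lintegral_const, Measure.restrict_apply_univ, Real.volume_Ico,
          Measure.smul_apply, smul_eq_mul, mul_comm]
        ring_nf

lemma quasi_linePoint : Measure.QuasiMeasurePreserving linePoint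
    ((volume.restrict Ω').prod (volume : Measure ℝ)) volume :=
  ⟨measurable_linePoint, (Measure.absolutelyContinuous_of_le map_linePoint_le).trans
    Measure.smul_absolutelyContinuous⟩

lemma measurableSet_Ω : MeasurableSet Ω := measurableSet_ball

instance : IsFiniteMeasure (volume.restrict Ω : Measure Plane) :=
  ⟨by rw [Measure.restrict_apply_univ]; exact measure_ball_lt_top⟩

instance : IsFiniteMeasure (volume.restrict Ω' : Measure (ℝ × ℝ)) :=
  ⟨by
    rw [Measure.restrict_apply_univ, Ω', Measure.volume_eq_prod, Measure.prod_prod,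
      Real.volume_Ioo, Real.volume_Ico]
    exact ENNReal.mul_lt_top ENNReal.ofReal_lt_top ENNReal.ofReal_lt_top⟩

lemma aestronglyMeasurable_line {f : Plane → ℝ}
    (hf : AEStronglyMeasurable f (volume.restrict Ω)) :
    AEStronglyMeasurable (fun w => Ω.indicator f (linePoint w))
      ((volume.restrict Ω').prod (volume : Measure ℝ)) :=
  ((aestronglyMeasurable_indicator_iff measurableSet_Ω).2 hf).comp_quasiMeasurePreserving
    quasi_linePoint

lemma integrable_line {f : Plane → ℝ} (hf : MemLp f 2 (volume.restrict Ω)) :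
    Integrable (fun w => Ω.indicator f (linePoint w))
      ((volume.restrict Ω').prod (volume : Measure ℝ)) := by
  have h1 : Integrable (Ω.indicator f) volume :=
    (integrable_indicator_iff measurableSet_Ω).2 (hf.integrable (by norm_num))
  have h2 : Integrable (Ω.indicator f)
      (((volume.restrict Ω').prod (volume : Measure ℝ)).map linePoint) :=
    (h1.smul_measure ENNReal.ofReal_ne_top).mono_measure map_linePoint_le
  exact h2.comp_measurable measurable_linePoint

lemma radonFun_congr {f g : Plane → ℝ} (h : f =ᵐ[volume.restrict Ω] g) :
    radonFun (Ω.indicator f) =ᵐ[volume.restrict Ω'] radonFun (Ω.indicator g) := by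
  have h1 : Ω.indicator f =ᵐ[volume] Ω.indicator g :=
    (ae_eq_restrict_iff_indicator_ae_eq measurableSet_Ω).1 h
  have h2 := Measure.ae_ae_of_ae_prod (quasi_linePoint.ae_eq_comp h1)
  filter_upwards [h2] with z hz
  exact integral_congr_ae hz

lemma radonFun_add {f g : Plane → ℝ} (hf : MemLp f 2 (volume.restrict Ω))
    (hg : MemLp g 2 (volume.restrict Ω)) :
    radonFun (Ω.indicator (f + g)) =ᵐ[volume.restrict Ω']
      radonFun (Ω.indicator f) + radonFun (Ω.indicator g) := by
  filter_upwards [(integrable_line hf).prod_right_ae, (integrable_line hg).prod_right_ae]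
    with z h1 h2
  simp only [radonFun, Pi.add_apply, indicator_add']
  exact integral_add h1 h2

lemma radonFun_smul (c : ℝ) (f : Plane → ℝ) :
    radonFun (Ω.indicator (c • f)) = c • radonFun (Ω.indicator f) := by
  ext z
  simp only [radonFun, Pi.smul_apply, smul_eq_mul, ← integral_const_mul]
  refine integral_congr_ae (ae_of_all _ fun t => ?_)
  change Ω.indicator (c • f) (linePoint (z, t)) = c * Ω.indicator f (linePoint (z, t))
  by_cases h : linePoint (z, t) ∈ Ω <;> simp [h]

lemma abs_le_of_mem {z : ℝ × ℝ} {t : ℝ} (h : linePoint (z, t) ∈ Ω) : t ∈ Ioo (-1 : ℝ) 1 := by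
  rw [Ω, mem_ball_zero_iff, EuclideanSpace.norm_eq, Real.sqrt_lt' one_pos] at h
  simp only [linePoint, dir, dirPerp, Fin.sum_univ_two, Real.norm_eq_abs, sq_abs] at h
  simp at h
  have := Real.sin_sq_add_cos_sq z.2
  have h3 : z.1 ^ 2 + t ^ 2 < 1 := by
    calc z.1 ^ 2 + t ^ 2 = (z.1 ^ 2 + t ^ 2) * (Real.sin z.2 ^ 2 + Real.cos z.2 ^ 2) := by
          rw [this, mul_one]
      _ < 1 := by linarith
  constructor <;> nlinarith [sq_nonneg z.1]

lemma enorm_radonFun_sq_le {f : Plane → ℝ} {z : ℝ × ℝ}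
    (h : AEStronglyMeasurable (fun t : ℝ => Ω.indicator f (linePoint (z, t))) volume) :
    ‖radonFun (Ω.indicator f) z‖ₑ ^ (2 : ℝ)
      ≤ 2 * ∫⁻ t : ℝ, ‖Ω.indicator f (linePoint (z, t))‖ₑ ^ (2 : ℝ) := by
  set u : ℝ → ℝ := fun t => Ω.indicator f (linePoint (z, t)) with hu
  have h0 : radonFun (Ω.indicator f) z = ∫ t in Ioo (-1 : ℝ) 1, u t := by
    refine (setIntegral_eq_integral_of_forall_compl_eq_zero fun t ht => ?_).symm
    exact indicator_of_notMem (fun hh => ht (abs_le_of_mem hh)) _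
  have h1 : ‖radonFun (Ω.indicator f) z‖ₑ ≤ eLpNorm u 1 (volume.restrict (Ioo (-1 : ℝ) 1)) := by
    rw [h0, eLpNorm_one_eq_lintegral_enorm]
    exact enorm_integral_le_lintegral_enorm _
  have h2 := h1.trans (eLpNorm_le_eLpNorm_mul_rpow_measure_univ
    (show (1 : ℝ≥0∞) ≤ 2 by norm_num) h.restrict)
  calc _ ≤ _ := ENNReal.rpow_le_rpow h2 (by norm_num : (0 : ℝ) ≤ 2)
    _ = 2 * ∫⁻ t in Ioo (-1 : ℝ) 1, ‖u t‖ₑ ^ (2 : ℝ) := by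
      rw [ENNReal.mul_rpow_of_nonneg _ _ (by norm_num),
        eLpNorm_eq_lintegral_rpow_enorm_toReal (by norm_num) (by norm_num),
        Measure.restrict_apply_univ, Real.volume_Ioo, ← ENNReal.rpow_mul, ← ENNReal.rpow_mul]
      norm_num
      ring
    _ ≤ _ := by gcongr; exact Measure.restrict_le_self

/-- A bound for the operator norm of the Radon transform. -/
def radonBound : ℝ≥0∞ := (2 * ENNReal.ofReal (2 * π)) ^ (1 / 2 : ℝ)

lemma radonBound_ne_top : radonBound ≠ ∞ :=
  ENNReal.rpow_ne_top_of_nonneg (by norm_num)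
    (ENNReal.mul_ne_top (by norm_num) ENNReal.ofReal_ne_top)

lemma aestronglyMeasurable_radonFun {f : Plane → ℝ}
    (hf : AEStronglyMeasurable f (volume.restrict Ω)) :
    AEStronglyMeasurable (radonFun (Ω.indicator f)) (volume.restrict Ω') :=
  (aestronglyMeasurable_line hf).integral_prod_right'

lemma eLpNorm_radonFun_le {f : Plane → ℝ} (hf : AEStronglyMeasurable f (volume.restrict Ω)) :
    eLpNorm (radonFun (Ω.indicator f)) 2 (volume.restrict Ω')
      ≤ radonBound * eLpNorm f 2 (volume.restrict Ω) := by
  have hm := aestronglyMeasurable_line hf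
  have key : ∫⁻ z in Ω', ‖radonFun (Ω.indicator f) z‖ₑ ^ (2 : ℝ)
      ≤ (2 * ENNReal.ofReal (2 * π)) * ∫⁻ x in Ω, ‖f x‖ₑ ^ (2 : ℝ) := by
    have hi : AEMeasurable (fun x => ‖Ω.indicator f x‖ₑ ^ (2 : ℝ)) volume :=
      ((aestronglyMeasurable_indicator_iff measurableSet_Ω).2 hf).enorm.pow_const _
    calc _ ≤ ∫⁻ z in Ω', 2 * ∫⁻ t : ℝ, ‖Ω.indicator f (linePoint (z, t))‖ₑ ^ (2 : ℝ) := by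
          refine lintegral_mono_ae ?_
          filter_upwards [hm.prodMk_left] with z hz
          exact enorm_radonFun_sq_le hz
      _ = 2 * ∫⁻ w, ‖Ω.indicator f (linePoint w)‖ₑ ^ (2 : ℝ)
            ∂((volume.restrict Ω').prod (volume : Measure ℝ)) := by
          rw [lintegral_const_mul' _ _ (by norm_num), lintegral_prod]
          exact hm.enorm.pow_const _
      _ = 2 * ∫⁻ x, ‖Ω.indicator f x‖ₑ ^ (2 : ℝ)
            ∂(((volume.restrict Ω').prod (volume : Measure ℝ)).map linePoint) := by
          rw [lintegral_map' (hi.mono_ac quasi_linePoint.absolutelyContinuous)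
            measurable_linePoint.aemeasurable]
      _ ≤ 2 * ∫⁻ x, ‖Ω.indicator f x‖ₑ ^ (2 : ℝ)
            ∂(ENNReal.ofReal (2 * π) • (volume : Measure Plane)) := by
          gcongr
          exact map_linePoint_le
      _ = _ := by
          rw [lintegral_smul_measure, smul_eq_mul, mul_assoc, ← lintegral_indicator measurableSet_Ω]
          congr 3
          ext x
          by_cases hx : x ∈ Ω <;> simp [hx]
  rw [eLpNorm_eq_lintegral_rpow_enorm_toReal (by norm_num) (by norm_num),
    eLpNorm_eq_lintegral_rpow_enorm_toReal (by norm_num) (by norm_num), radonBound, ENNReal.toReal_ofNat,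
    ← ENNReal.mul_rpow_of_nonneg _ _ (by norm_num)]
  exact ENNReal.rpow_le_rpow key (by norm_num)

lemma memLp_radonFun {f : Plane → ℝ} (hf : MemLp f 2 (volume.restrict Ω)) :
    MemLp (radonFun (Ω.indicator f)) 2 (volume.restrict Ω') :=
  ⟨aestronglyMeasurable_radonFun hf.1, (eLpNorm_radonFun_le hf.1).trans_lt
    (ENNReal.mul_lt_top radonBound_ne_top.lt_top hf.2)⟩

/-- The Radon transform as a linear map on classes of functions: the class of `f` is sent to the
class of the Radon transform of the extension of `f` by zero. -/
def radonLinear : L2Image →ₗ[ℝ] L2Sinogram where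
  toFun f := (memLp_radonFun (Lp.memLp f)).toLp (radonFun (Ω.indicator f))
  map_add' f g :=
    (MemLp.toLp_congr _ ((memLp_radonFun (Lp.memLp f)).add (memLp_radonFun (Lp.memLp g)))
      ((radonFun_congr (Lp.coeFn_add f g)).trans
        (radonFun_add (Lp.memLp f) (Lp.memLp g)))).trans (MemLp.toLp_add _ _)
  map_smul' c f :=
    (MemLp.toLp_congr _ ((memLp_radonFun (Lp.memLp f)).const_smul c)
      ((radonFun_congr (Lp.coeFn_smul c f)).trans
        (Eq.eventuallyEq (radonFun_smul c f)))).trans (MemLp.toLp_const_smul _ _)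

lemma norm_radonLinear_le (f : L2Image) : ‖radonLinear f‖ ≤ radonBound.toReal * ‖f‖ := by
  have h : ‖radonLinear f‖
      = (eLpNorm (radonFun (Ω.indicator f)) 2 (volume.restrict Ω')).toReal :=
    Lp.norm_toLp _ (memLp_radonFun (Lp.memLp f))
  rw [h, Lp.norm_def, ← ENNReal.toReal_mul]
  exact ENNReal.toReal_mono (ENNReal.mul_ne_top radonBound_ne_top (Lp.eLpNorm_ne_top f))
    (eLpNorm_radonFun_le (Lp.memLp f).1)

/-- The Radon transform as a continuous linear operator `L²(Ω) → L²(Ω')`. -/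
def radon : L2Image →L[ℝ] L2Sinogram :=
  radonLinear.mkContinuous radonBound.toReal norm_radonLinear_le

lemma coeFn_radon (f : L2Image) :
    radon f =ᵐ[volume.restrict Ω'] radonFun (Ω.indicator f) :=
  MemLp.coeFn_toLp (memLp_radonFun (Lp.memLp f))

/-- Discretization parameters: `P` detector offsets at distance `δs`, `Q` angles
`φ 1 < ⋯ < φ Q` in `[-π,π[`, and an image grid of `N × M` pixels of side length `δx`.
The values `φ 0 = φ Q - 2π` and `φ (Q + 1) = φ 1 + 2π` extend the angles periodically;
further values of `φ` are irrelevant. -/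
structure Discretization where
  P : ℕ
  Q : ℕ
  N : ℕ
  M : ℕ
  δs : ℝ
  δx : ℝ
  φ : ℕ → ℝ
  δs_pos : 0 < δs
  δx_pos : 0 < δx
  one_le_Q : 1 ≤ Q
  φ_mem : ∀ q, 1 ≤ q → q ≤ Q → φ q ∈ Ico (-π) π
  φ_lt : ∀ q, 1 ≤ q → q < Q → φ q < φ (q + 1)
  φ_zero : φ 0 = φ Q - 2 * π
  φ_succ : φ (Q + 1) = φ 1 + 2 * π

namespace Discretization

variable (D : Discretization)

/-- The angular width `δφ = max_q (φ_{q+1} - φ_q)`. -/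
def δφ : ℝ :=
  (Finset.Icc 1 D.Q).sup' ⟨1, Finset.mem_Icc.2 ⟨le_rfl, D.one_le_Q⟩⟩ fun q => D.φ (q + 1) - D.φ q

/-- The detector offsets `s_p = δs (p - (P+1)/2)`. -/
def s (p : ℕ) : ℝ := D.δs * ((p : ℝ) - ((D.P : ℝ) + 1) / 2)

/-- The detector pixels `S_p = s_p + [-δs/2, δs/2[`. -/
def S (p : ℕ) : Set ℝ := Ico (D.s p - D.δs / 2) (D.s p + D.δs / 2)

/-- The angular pixels `Φ_q = [(φ_{q-1}+φ_q)/2, (φ_q+φ_{q+1})/2[`, taken modulo `2π`. -/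
def Φ (q : ℕ) : Set ℝ :=
  {φ | ∃ k : ℤ, φ + k * (2 * π) ∈
    Ico ((D.φ (q - 1) + D.φ q) / 2) ((D.φ q + D.φ (q + 1)) / 2)}

/-- The pixel centers `x_ij = δx (i - (N+1)/2, j - (M+1)/2)`. -/
def x (i j : ℕ) : Plane :=
  !₂[D.δx * ((i : ℝ) - ((D.N : ℝ) + 1) / 2), D.δx * ((j : ℝ) - ((D.M : ℝ) + 1) / 2)]

/-- The image pixels `X_ij = x_ij + [-δx/2, δx/2[²`. -/
def X (i j : ℕ) : Set Plane :=
  {y | ∀ k : Fin 2, y k ∈ Ico (D.x i j k - D.δx / 2) (D.x i j k + D.δx / 2)}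

/-- The image pixels cover `Ω` and the sinogram pixels cover `Ω'`. -/
def Compatible : Prop :=
  Ω ⊆ (⋃ i ∈ Finset.Icc 1 D.N, ⋃ j ∈ Finset.Icc 1 D.M, D.X i j) ∧
  Ω' ⊆ (⋃ p ∈ Finset.Icc 1 D.P, ⋃ q ∈ Finset.Icc 1 D.Q, D.S p ×ˢ D.Φ q)

/-- The pixel values `f_ij = δx⁻² ∫_{X_ij} f`. -/
def pixelValue (f : Plane → ℝ) (i j : ℕ) : ℝ := 1 / D.δx ^ 2 * ∫ y in D.X i j, f y

end Discretization

/-- The hat function `w_δ(t) = max(0, δ - |t|)`. -/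
def hat (δ t : ℝ) : ℝ := max 0 (δ - |t|)

/-- The fully discrete (pixel-driven) Radon transform of a function on the plane, at
`z = (s, φ)`. -/
def discreteRadonFun (D : Discretization) (f : Plane → ℝ) (z : ℝ × ℝ) : ℝ :=
  D.δx ^ 2 / D.δs ^ 2 * ∑ p ∈ Finset.Icc 1 D.P, ∑ q ∈ Finset.Icc 1 D.Q,
    (D.S p).indicator 1 z.1 * (D.Φ q).indicator 1 z.2 *
      ∑ i ∈ Finset.Icc 1 D.N, ∑ j ∈ Finset.Icc 1 D.M,
        hat D.δs (⟪D.x i j, dir (D.φ q)⟫ - D.s p) * D.pixelValue f i j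

/-! Auxiliary facts: this is a bounded operator `L²(Ω) → L²(Ω')`. -/

lemma measurableSet_Φ (D : Discretization) (q : ℕ) : MeasurableSet (D.Φ q) := by
  have h : D.Φ q = ⋃ k : ℤ, (fun φ : ℝ => φ + k * (2 * π)) ⁻¹'
      Ico ((D.φ (q - 1) + D.φ q) / 2) ((D.φ q + D.φ (q + 1)) / 2) := by
    ext φ
    simp only [Discretization.Φ, mem_ofPred_eq, mem_iUnion, mem_preimage]
  rw [h]
  exact MeasurableSet.iUnion fun k => (by fun_prop : Measurable _) measurableSet_Ico

lemma measurableSet_X (D : Discretization) (i j : ℕ) : MeasurableSet (D.X i j) := by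
  have h : D.X i j = ⋂ k : Fin 2, (fun y : Plane => y k) ⁻¹'
      Ico (D.x i j k - D.δx / 2) (D.x i j k + D.δx / 2) := by
    ext y
    simp [Discretization.X]
  rw [h]
  exact MeasurableSet.iInter fun k => (by fun_prop : Measurable _) measurableSet_Ico

lemma measurableSet_sinogramPixel (D : Discretization) (p q : ℕ) :
    MeasurableSet (D.S p ×ˢ D.Φ q) :=
  MeasurableSet.prod measurableSet_Ico (measurableSet_Φ D q)

/-- The pixel value of the extension by zero, as a functional on `L²(Ω)`. -/
def pixelFunctional (D : Discretization) (i j : ℕ) : L2Image →L[ℝ] ℝ :=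
  (1 / D.δx ^ 2) • innerSL ℝ (indicatorConstLp 2 (measurableSet_X D i j)
    (measure_ne_top (volume.restrict Ω) _) (1 : ℝ))

lemma pixelFunctional_apply (D : Discretization) (i j : ℕ) (f : L2Image) :
    pixelFunctional D i j f = D.pixelValue (Ω.indicator f) i j := by
  rw [pixelFunctional, Discretization.pixelValue, _root_.smul_apply, innerSL_apply_apply,
    L2.inner_indicatorConstLp_one, smul_eq_mul, Measure.restrict_restrict (measurableSet_X D i j),
    setIntegral_indicator measurableSet_Ω]

/-- The fully discrete Radon transform, written as an operator of finite rank. -/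
def discreteRadonAux (D : Discretization) : L2Image →L[ℝ] L2Sinogram :=
  (D.δx ^ 2 / D.δs ^ 2) • ∑ p ∈ Finset.Icc 1 D.P, ∑ q ∈ Finset.Icc 1 D.Q,
    (∑ i ∈ Finset.Icc 1 D.N, ∑ j ∈ Finset.Icc 1 D.M,
      hat D.δs (⟪D.x i j, dir (D.φ q)⟫ - D.s p) • pixelFunctional D i j).smulRight
        (indicatorConstLp 2 (measurableSet_sinogramPixel D p q)
          (measure_ne_top (volume.restrict Ω') _) (1 : ℝ))

lemma coeFn_finsetSum {ι : Type*} (t : Finset ι) (F : ι → L2Sinogram) (G : ι → ℝ × ℝ → ℝ)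
    (h : ∀ i ∈ t, F i =ᵐ[volume.restrict Ω'] G i) :
    (↑(∑ i ∈ t, F i) : ℝ × ℝ → ℝ) =ᵐ[volume.restrict Ω'] fun z => ∑ i ∈ t, G i z := by
  classical
  induction t using Finset.induction_on with
  | empty =>
    filter_upwards [Lp.coeFn_zero ℝ 2 (volume.restrict Ω' : Measure (ℝ × ℝ))] with z hz
    simpa using hz
  | insert a t ha ih =>
    rw [Finset.sum_insert ha]
    filter_upwards [Lp.coeFn_add (F a) (∑ i ∈ t, F i), h a (Finset.mem_insert_self a t),
      ih fun i hi => h i (Finset.mem_insert_of_mem hi)] with z h1 h2 h3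
    rw [h1, Pi.add_apply, h2, h3, Finset.sum_insert ha]

lemma coeFn_discreteRadonAux (D : Discretization) (f : L2Image) :
    discreteRadonAux D f =ᵐ[volume.restrict Ω'] discreteRadonFun D (Ω.indicator f) := by
  rw [discreteRadonAux, _root_.smul_apply]
  refine (Lp.coeFn_smul _ _).trans ?_
  simp only [_root_.sum_apply]
  refine EventuallyEq.trans (EventuallyEq.const_smul (coeFn_finsetSum _ _
    (fun p z => ∑ q ∈ Finset.Icc 1 D.Q, (D.S p).indicator 1 z.1 * (D.Φ q).indicator 1 z.2 *
      ∑ i ∈ Finset.Icc 1 D.N, ∑ j ∈ Finset.Icc 1 D.M,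
        hat D.δs (⟪D.x i j, dir (D.φ q)⟫ - D.s p) * D.pixelValue (Ω.indicator f) i j)
    fun p _ => coeFn_finsetSum _ _ _ fun q _ => ?_) _) (Eq.eventuallyEq rfl)
  rw [ContinuousLinearMap.smulRight_apply]
  filter_upwards [Lp.coeFn_smul ((∑ i ∈ Finset.Icc 1 D.N, ∑ j ∈ Finset.Icc 1 D.M,
      hat D.δs (⟪D.x i j, dir (D.φ q)⟫ - D.s p) • pixelFunctional D i j) f)
      (indicatorConstLp 2 (measurableSet_sinogramPixel D p q)
          (measure_ne_top (volume.restrict Ω') _) (1 : ℝ)),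
    indicatorConstLp_coeFn (p := 2) (hs := measurableSet_sinogramPixel D p q)
      (hμs := measure_ne_top (volume.restrict Ω') _) (c := (1 : ℝ))] with z h1 h2
  rw [h1, Pi.smul_apply, h2, smul_eq_mul, mul_comm]
  simp only [_root_.sum_apply, _root_.smul_apply, smul_eq_mul,
    pixelFunctional_apply]
  congr 1
  by_cases hp : z.1 ∈ D.S p <;> by_cases hq : z.2 ∈ D.Φ q <;> simp [indicator, hp, hq]

lemma memLp_discreteRadonFun (D : Discretization) (f : L2Image) :
    MemLp (discreteRadonFun D (Ω.indicator f)) 2 (volume.restrict Ω') :=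
  (memLp_congr_ae (coeFn_discreteRadonAux D f)).1 (Lp.memLp _)

lemma toLp_discreteRadonFun (D : Discretization) (f : L2Image) :
    (memLp_discreteRadonFun D f).toLp (discreteRadonFun D (Ω.indicator f))
      = discreteRadonAux D f :=
  Lp.ext ((MemLp.coeFn_toLp _).trans (coeFn_discreteRadonAux D f).symm)

/-- The fully discrete (pixel-driven) Radon transform as a continuous linear operator
`L²(Ω) → L²(Ω')`; functions on `Ω` are extended by zero. -/
def discreteRadon (D : Discretization) : L2Image →L[ℝ] L2Sinogram where
  toFun f := (memLp_discreteRadonFun D f).toLp (discreteRadonFun D (Ω.indicator f))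
  map_add' f g := by simp only [toLp_discreteRadonFun, map_add]
  map_smul' c f := by simp only [toLp_discreteRadonFun, map_smul, RingHom.id_apply]
  cont := by
    simp only [toLp_discreteRadonFun]
    exact (discreteRadonAux D).continuous

end PixelRadon

end

namespace PixelRadon

open MeasureTheory Set Filter Topology
open scoped Real ENNReal RealInnerProductSpace

/-! ### Integrals of bounded functions -/

/-! Everything follows from one explicit bound: the operator error is at most 40((δx+δφ)/δs + √δs)
as soon as δx+δφ ≤ δs (`norm_discreteRadon_sub_radon_le`).

Write RF for the Radon transform. Between it and its discretization stands the ridge average m =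
δs⁻² ∫ hat(y·ϑ(φ) − s_p) F(y) dy, which by Fubini is a weighted mean of RF(·,φ) near s. Replacing
y·ϑ(φ) by x_ij·ϑ(φ_q) moves the argument of the 1-Lipschitz hat by at most δx+δφ, so the discrete
value differs from m by at most a constant times (δx+δφ)/δs times a local mean of R|F|. The
remaining error m − RF is controlled by a local mean of the increments RF(s+h) − RF(s) with |h| ≤
3δs/2. By Cauchy–Schwarz it then suffices to bound the energy of R|F| by ‖F‖², and that of the
increments by |h|‖F‖², which is the order-1/2 regularity of RF in s.

The regularity is obtained without Fourier analysis. The autocorrelation of RF(·,φ) in s is the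
Radon transform of the planar autocorrelation C of F (`radonFun_autocorr`). After integration over φ
only the circular integrals c(ρ) of C matter: the correlation at lag h is 2∫₀^∞ c(√(h²+τ²)) dτ. The
energy of the increment is thus four times ∫₀^∞ c(τ) dτ − ∫₀^∞ c(√(h²+τ²)) dτ. Since |c| ≤ 2π‖F‖²,
the substitution ρ = √(h²+τ²) bounds this difference by a multiple of |h|‖F‖², with no smoothness of
F (`integral_Ioi_sub_comp_sqrt_le`, `integral_radonFun_increment_sq_le`).

Bounded F supported in the ball make every use of Fubini harmless; density of bounded continuous
functions in L² gives the operator norm. -/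

lemma integrable_of_bounded_of_support {α : Type*} [MeasurableSpace α] {μ : Measure α} {g : α → ℝ}
    (hg : Measurable g) {B : ℝ} (hB : ∀ x, |g x| ≤ B) {A : Set α} (hA : μ A ≠ ∞)
    (hs : ∀ x, x ∉ A → g x = 0) : Integrable g μ :=
  (integrableOn_iff_integrable_of_support_subset
    (fun x hx => by_contra fun h => hx (hs x h))).1
    (Measure.integrableOn_of_bounded hA hg.aestronglyMeasurable (ae_of_all _ hB))

/-- Cauchy–Schwarz against the constant 1, read off from the nonnegativity of the integral of `((b -
a) * g x - I) ^ 2`. -/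
lemma sq_setIntegral_Icc_le {g : ℝ → ℝ} (hg : Measurable g) {B : ℝ} (hB : ∀ x, |g x| ≤ B)
    {a b : ℝ} (hab : a < b) :
    (∫ x in Icc a b, g x) ^ 2 ≤ (b - a) * ∫ x in Icc a b, g x ^ 2 := by
  have hi : Integrable g (volume.restrict (Icc a b)) :=
    Integrable.of_bound hg.aestronglyMeasurable B (ae_of_all _ hB)
  have hi2 : Integrable (fun x => g x ^ 2) (volume.restrict (Icc a b)) :=
    Integrable.of_bound (hg.pow_const 2).aestronglyMeasurable (B ^ 2) (ae_of_all _ fun x => by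
      rw [Real.norm_eq_abs, abs_pow]
      gcongr
      exact hB x)
  set I := ∫ x in Icc a b, g x with hI
  have h0 : 0 ≤ ∫ x in Icc a b, ((b - a) * g x - I) ^ 2 := integral_nonneg fun x => sq_nonneg _
  have h1 : ∫ x in Icc a b, ((b - a) * g x - I) ^ 2
      = (b - a) ^ 2 * (∫ x in Icc a b, g x ^ 2) - 2 * (b - a) * I * I + I ^ 2 * (b - a) := by
    have : ∀ x, ((b - a) * g x - I) ^ 2
        = (b - a) ^ 2 * g x ^ 2 - 2 * (b - a) * I * g x + I ^ 2 := fun x => by ring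
    simp only [this]
    have hi3 : Integrable (fun x => (b - a) ^ 2 * g x ^ 2 - 2 * (b - a) * I * g x)
        (volume.restrict (Icc a b)) := (hi2.const_mul _).sub (hi.const_mul _)
    rw [integral_add hi3 (integrable_const _), integral_sub (hi2.const_mul _) (hi.const_mul _), integral_const_mul, integral_const_mul,
      setIntegral_const, Real.volume_real_Icc_of_le hab.le, smul_eq_mul]
    ring
  rw [h1] at h0
  have h2 : 0 ≤ (b - a) * ((b - a) * (∫ x in Icc a b, g x ^ 2) - I ^ 2) := by linarith
  have := nonneg_of_mul_nonneg_right h2 (by linarith)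
  linarith

/-! ### Bounded functions supported in a ball -/

/-- A bounded measurable function on the plane that vanishes outside the open ball of radius `r`. -/
structure BoundedOnBall (r : ℝ) (F : Plane → ℝ) : Prop where
  measurable : Measurable F
  bounded : ∃ B, ∀ x, |F x| ≤ B
  eq_zero : ∀ x, r ≤ ‖x‖ → F x = 0

lemma norm_linePoint_sq (s φ t : ℝ) : ‖s • dir φ + t • dirPerp φ‖ ^ 2 = s ^ 2 + t ^ 2 := by
  rw [EuclideanSpace.norm_sq_eq]
  simp [dir, dirPerp, Fin.sum_univ_two]
  linear_combination (s ^ 2 + t ^ 2) * Real.sin_sq_add_cos_sq φ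

lemma inner_linePoint (s φ t : ℝ) : ⟪s • dir φ + t • dirPerp φ, dir φ⟫ = s := by
  simp [dir, dirPerp, PiLp.inner_apply, Fin.sum_univ_two]
  linear_combination s * Real.sin_sq_add_cos_sq φ

lemma linePoint_coords (x : Plane) (φ : ℝ) :
    ⟪x, dir φ⟫ • dir φ + ⟪x, dirPerp φ⟫ • dirPerp φ = x := by
  have h := Real.sin_sq_add_cos_sq φ
  ext i
  fin_cases i
  · simp [dir, dirPerp, PiLp.inner_apply, Fin.sum_univ_two]
    linear_combination x 0 * h
  · simp [dir, dirPerp, PiLp.inner_apply, Fin.sum_univ_two]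
    linear_combination x 1 * h

lemma norm_dir (φ : ℝ) : ‖dir φ‖ = 1 := (orthonormal_dir φ).1 0

lemma continuous_dir : Continuous dir := by
  unfold dir
  fun_prop

lemma integral_plane_eq {G : Plane → ℝ} (hG : Measurable G) (hi : Integrable G) (φ : ℝ) :
    ∫ x, G x = ∫ s : ℝ, ∫ t : ℝ, G (s • dir φ + t • dirPerp φ) := by
  have hm := measurePreserving_line φ
  have h1 : ∫ x, G x = ∫ p : ℝ × ℝ, G (p.1 • dir φ + p.2 • dirPerp φ) := by
    rw [← hm.map_eq, integral_map hm.measurable.aemeasurable hG.aestronglyMeasurable]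
  rw [h1, Measure.volume_eq_prod, integral_prod]
  rw [← Measure.volume_eq_prod]
  exact hm.integrable_comp_of_integrable hi

namespace BoundedOnBall

variable {r : ℝ} {F : Plane → ℝ}

lemma integrable (hF : BoundedOnBall r F) : Integrable F := by
  obtain ⟨B, hB⟩ := hF.bounded
  exact integrable_of_bounded_of_support hF.measurable hB
    (measure_ball_lt_top (x := (0 : Plane)) (r := r)).ne
    fun x hx => hF.eq_zero x (by simpa using hx)

lemma abs (hF : BoundedOnBall r F) : BoundedOnBall r fun x => |F x| where
  measurable := by simpa only [Real.norm_eq_abs] using hF.measurable.norm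
  bounded := by simpa using hF.bounded
  eq_zero x hx := by simp [hF.eq_zero x hx]

lemma line_eq_zero_of_left (hF : BoundedOnBall r F) {s : ℝ} (hs : r ≤ |s|) (φ t : ℝ) :
    F (s • dir φ + t • dirPerp φ) = 0 := by
  refine hF.eq_zero _ (hs.trans ?_)
  rw [← abs_of_nonneg (norm_nonneg (s • dir φ + t • dirPerp φ)), ← sq_le_sq, norm_linePoint_sq]
  nlinarith

lemma line_eq_zero_of_right (hF : BoundedOnBall r F) {t : ℝ} (ht : r ≤ |t|) (s φ : ℝ) :
    F (s • dir φ + t • dirPerp φ) = 0 := by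
  refine hF.eq_zero _ (ht.trans ?_)
  rw [← abs_of_nonneg (norm_nonneg (s • dir φ + t • dirPerp φ)), ← sq_le_sq, norm_linePoint_sq]
  nlinarith

lemma measurable_comp_linePoint (hF : BoundedOnBall r F) : Measurable fun w => F (linePoint w) :=
  hF.measurable.comp measurable_linePoint

lemma measurable_radonFun (hF : BoundedOnBall r F) : Measurable (radonFun F) :=
  (hF.measurable_comp_linePoint.stronglyMeasurable.integral_prod_right'
    (ν := (volume : Measure ℝ))).measurable

lemma radonFun_eq_zero (hF : BoundedOnBall r F) {s : ℝ} (hs : r ≤ |s|) (φ : ℝ) :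
    radonFun F (s, φ) = 0 := by
  simp [radonFun, hF.line_eq_zero_of_left hs]

lemma exists_radonFun_le (hF : BoundedOnBall r F) : ∃ B, ∀ z, |radonFun F z| ≤ B := by
  obtain ⟨B, hB⟩ := hF.bounded
  refine ⟨B * volume.real (Icc (-r) r), fun z => ?_⟩
  rw [radonFun, ← setIntegral_eq_integral_of_forall_compl_eq_zero (s := Icc (-r) r)]
  · exact norm_setIntegral_le_of_norm_le_const (f := fun t : ℝ => F (linePoint (z, t)))
      (by simp) fun t _ => hB _
  · intro t ht
    refine hF.line_eq_zero_of_right ?_ _ _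
    by_contra! h
    exact ht (abs_le.1 h.le)

/-- In rotated coordinates a ridge function depends on the offset alone, so it leaves the integral
along the line. This turns planar weighted integrals into one-dimensional ones of the Radon
transform. -/
lemma integral_ridge_mul (hF : BoundedOnBall r F) {ψ : ℝ → ℝ} (hψ : Measurable ψ) {B : ℝ}
    (hB : ∀ v, |ψ v| ≤ B) (φ : ℝ) :
    ∫ x, ψ ⟪x, dir φ⟫ * F x = ∫ v, ψ v * radonFun F (v, φ) := by
  have hm : Measurable fun x : Plane => ψ ⟪x, dir φ⟫ := hψ.comp (by fun_prop)
  rw [integral_plane_eq (G := fun x => ψ ⟪x, dir φ⟫ * F x) (hm.mul hF.measurable)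
    (hF.integrable.bdd_mul hm.aestronglyMeasurable (ae_of_all _ fun x => hB _)) φ]
  simp only [inner_linePoint, integral_const_mul, radonFun]

lemma integrable_sq (hF : BoundedOnBall r F) : Integrable fun x => F x ^ 2 := by
  obtain ⟨B, hB⟩ := hF.bounded
  simp only [pow_two]
  exact hF.integrable.bdd_mul hF.measurable.aestronglyMeasurable (ae_of_all _ hB)

end BoundedOnBall

/-! ### Autocorrelation -/

/-- The autocorrelation `z ↦ ∫ F(x) F(x + z) dx`. -/
noncomputable def autocorr (F : Plane → ℝ) (z : Plane) : ℝ := ∫ x, F x * F (x + z)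

namespace BoundedOnBall

variable {r : ℝ} {F : Plane → ℝ}

/-- From |ab| ≤ (a² + b²)/2 and translation invariance. This sup bound lets all later constants
depend on F only through its L² norm. -/
lemma abs_autocorr_le (hF : BoundedOnBall r F) (z : Plane) :
    |autocorr F z| ≤ ∫ x, F x ^ 2 := by
  have h2 : ∫ x, F (x + z) ^ 2 = ∫ x, F x ^ 2 :=
    integral_add_right_eq_self (μ := (volume : Measure Plane)) (fun x => F x ^ 2) z
  have hi2 : Integrable fun x => F (x + z) ^ 2 :=
    hF.integrable_sq.comp_add_right z
  calc |autocorr F z| ≤ ∫ x, |F x * F (x + z)| := abs_integral_le_integral_abs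
    _ ≤ ∫ x, (F x ^ 2 / 2 + F (x + z) ^ 2 / 2) := by
      refine integral_mono_of_nonneg (ae_of_all _ fun x => abs_nonneg _)
        ((hF.integrable_sq.div_const 2).add (hi2.div_const 2)) (ae_of_all _ fun x => ?_)
      simp only [abs_mul]
      nlinarith [sq_nonneg (|F x| - |F (x + z)|), sq_abs (F x), sq_abs (F (x + z))]
    _ = ∫ x, F x ^ 2 := by
      rw [integral_add (hF.integrable_sq.div_const 2) (hi2.div_const 2), integral_div,
        integral_div, h2]
      ring

lemma autocorr (hF : BoundedOnBall r F) : BoundedOnBall (2 * r) (autocorr F) where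
  measurable := by
    have h : Measurable fun p : Plane × Plane => F p.2 * F (p.2 + p.1) :=
      (hF.measurable.comp measurable_snd).mul (hF.measurable.comp (by fun_prop))
    exact (h.stronglyMeasurable.integral_prod_right' (ν := (volume : Measure Plane))).measurable
  bounded := ⟨_, hF.abs_autocorr_le⟩
  eq_zero z hz := by
    rw [PixelRadon.autocorr]
    refine integral_eq_zero_of_ae (ae_of_all _ fun x => ?_)
    by_contra h
    have h1 : ‖x‖ < r := by
      by_contra! hx
      exact h (by simp [hF.eq_zero x hx])
    have h2 : ‖x + z‖ < r := by
      by_contra! hx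
      exact h (by simp [hF.eq_zero _ hx])
    have : ‖z‖ ≤ ‖x + z‖ + ‖x‖ := by
      simpa using norm_sub_le (x + z) x
    linarith

lemma radonFun_autocorr (hF : BoundedOnBall r F) (h φ : ℝ) :
    radonFun (PixelRadon.autocorr F) (h, φ)
      = ∫ s, radonFun F (s + h, φ) * radonFun F (s, φ) := by
  obtain ⟨B, hB⟩ := hF.bounded
  obtain ⟨B', hB'⟩ := hF.exists_radonFun_le
  -- For Fubini: a nonzero integrand forces ‖x‖ < r and ‖x + z‖ < r, where z is the point at offset
  -- h and position τ, hence |τ| ≤ ‖z‖ < 2r.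
  have hi : Integrable (Function.uncurry fun (τ : ℝ) (x : Plane) =>
      F x * F (x + (h • dir φ + τ • dirPerp φ))) (volume.prod volume) := by
    refine integrable_of_bounded_of_support (B := B * B)
      (A := Icc (-(2 * r)) (2 * r) ×ˢ Metric.ball (0 : Plane) r) ?_ ?_ ?_ ?_
    · exact (hF.measurable.comp measurable_snd).mul (hF.measurable.comp (by fun_prop))
    · rintro ⟨τ, x⟩
      simp only [Function.uncurry_apply_pair, abs_mul]
      exact mul_le_mul (hB _) (hB _) (abs_nonneg _) ((abs_nonneg _).trans (hB 0))
    · rw [Measure.prod_prod]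
      exact ENNReal.mul_ne_top (by simp) measure_ball_lt_top.ne
    · rintro ⟨τ, x⟩ hτ
      simp only [Function.uncurry_apply_pair]
      by_contra h0
      have h1 : ‖x‖ < r := by
        by_contra! hx
        exact h0 (by simp [hF.eq_zero x hx])
      have h2 : ‖x + (h • dir φ + τ • dirPerp φ)‖ < r := by
        by_contra! hx
        exact h0 (by simp [hF.eq_zero _ hx])
      have h3 : ‖h • dir φ + τ • dirPerp φ‖ < 2 * r := by
        have : ‖h • dir φ + τ • dirPerp φ‖ ≤ ‖x + (h • dir φ + τ • dirPerp φ)‖ + ‖x‖ := by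
          simpa using norm_sub_le (x + (h • dir φ + τ • dirPerp φ)) x
        linarith
      have h4 : |τ| ≤ ‖h • dir φ + τ • dirPerp φ‖ := by
        rw [← abs_of_nonneg (norm_nonneg (h • dir φ + τ • dirPerp φ)), ← sq_le_sq,
          norm_linePoint_sq]
        nlinarith
      exact hτ ⟨abs_le.1 (h4.trans h3.le), by simpa using h1⟩
  have hinner : ∀ x : Plane, ∫ τ : ℝ, F (x + (h • dir φ + τ • dirPerp φ))
      = radonFun F (⟪x, dir φ⟫ + h, φ) := by
    intro x
    -- Translating τ along the line removes the component of x in the direction `dirPerp φ`; only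
    -- its offset remains.
    rw [radonFun, ← integral_add_right_eq_self _ (-⟪x, dirPerp φ⟫)]
    congr 1
    ext τ
    congr 1
    nth_rewrite 1 [← linePoint_coords x φ]
    module
  calc radonFun (PixelRadon.autocorr F) (h, φ)
      = ∫ τ : ℝ, ∫ x : Plane, F x * F (x + (h • dir φ + τ • dirPerp φ)) := rfl
    _ = ∫ x : Plane, radonFun F (⟪x, dir φ⟫ + h, φ) * F x := by
      rw [integral_integral_swap hi]
      simp only [integral_const_mul, hinner, mul_comm]
    _ = _ := hF.integral_ridge_mul (ψ := fun v => radonFun F (v + h, φ))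
        (hF.measurable_radonFun.comp (by fun_prop)) (fun v => hB' _) φ

end BoundedOnBall

/-! ### A one-dimensional comparison of integrals -/

lemma image_sqrt_sq_add_sq {h : ℝ} (hh : 0 < h) :
    (fun τ : ℝ => √(h ^ 2 + τ ^ 2)) '' Ioi 0 = Ioi h := by
  ext y
  constructor
  · rintro ⟨τ, hτ, rfl⟩
    exact Real.lt_sqrt_of_sq_lt (by nlinarith [mem_Ioi.1 hτ])
  · intro hy
    have hy' : h < y := hy
    refine ⟨√(y ^ 2 - h ^ 2), Real.sqrt_pos.2 (by nlinarith), ?_⟩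
    simp only
    rw [Real.sq_sqrt (by nlinarith), add_sub_cancel, Real.sqrt_sq (by linarith)]

lemma hasDerivAt_sqrt_sq_add_sq {h : ℝ} (hh : 0 < h) (τ : ℝ) :
    HasDerivAt (fun τ : ℝ => √(h ^ 2 + τ ^ 2)) (τ / √(h ^ 2 + τ ^ 2)) τ := by
  have h1 : HasDerivAt (fun τ : ℝ => h ^ 2 + τ ^ 2) (2 * τ) τ := by
    simpa using (hasDerivAt_pow 2 τ).const_add (h ^ 2)
  convert h1.sqrt (by positivity) using 1
  rw [mul_div_mul_left _ _ two_ne_zero]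

lemma integral_Ioi_eq_integral_comp_sqrt {h : ℝ} (hh : 0 < h) (a : ℝ → ℝ) :
    ∫ ρ in Ioi h, a ρ
      = ∫ τ in Ioi (0 : ℝ), τ / √(h ^ 2 + τ ^ 2) * a (√(h ^ 2 + τ ^ 2)) := by
  rw [← image_sqrt_sq_add_sq hh, integral_image_eq_integral_abs_deriv_smul measurableSet_Ioi
    (fun τ _ => (hasDerivAt_sqrt_sq_add_sq hh τ).hasDerivWithinAt)]
  · refine setIntegral_congr_fun measurableSet_Ioi fun τ hτ => ?_
    have : 0 ≤ τ / √(h ^ 2 + τ ^ 2) := div_nonneg (le_of_lt hτ) (Real.sqrt_nonneg _)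
    simp only [smul_eq_mul, abs_of_nonneg this]
  · intro x hx y hy hxy
    have hx' : 0 < x := hx
    have hy' : 0 < y := hy
    have := (Real.sqrt_inj (by positivity) (by positivity)).1 hxy
    have h2 : x ^ 2 = y ^ 2 := by linarith
    exact (sq_eq_sq₀ hx'.le hy'.le).1 h2

lemma div_sqrt_mem {h : ℝ} {τ : ℝ} (hτ : 0 ≤ τ) : τ / √(h ^ 2 + τ ^ 2) ∈ Icc (0 : ℝ) 1 := by
  refine ⟨div_nonneg hτ (Real.sqrt_nonneg _), div_le_one_of_le₀ ?_ (Real.sqrt_nonneg _)⟩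
  exact Real.le_sqrt_of_sq_le (by nlinarith [sq_nonneg h])

/-- The primitive τ − √(h² + τ²) starts at −h and is never positive, so the bound does not depend on
R. -/
lemma integral_one_sub_div_sqrt_le {h R : ℝ} (hh : 0 < h) :
    ∫ τ in (0 : ℝ)..R, (1 - τ / √(h ^ 2 + τ ^ 2)) ≤ h := by
  have hc : Continuous fun τ : ℝ => 1 - τ / √(h ^ 2 + τ ^ 2) :=
    continuous_const.sub (continuous_id.div (by fun_prop) fun τ => by positivity)
  rw [intervalIntegral.integral_eq_sub_of_hasDerivAt
    (f := fun τ => τ - √(h ^ 2 + τ ^ 2))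
    (fun τ _ => (hasDerivAt_id τ).sub (hasDerivAt_sqrt_sq_add_sq hh τ))
    (hc.intervalIntegrable _ _)]
  have h1 : √(h ^ 2 + 0 ^ 2) = h := by simp [Real.sqrt_sq hh.le]
  have h2 : R ≤ √(h ^ 2 + R ^ 2) := Real.le_sqrt_of_sq_le (by nlinarith)
  simp only [h1]
  linarith

/-- One `A * h` comes from the stretch (0, h], which ρ = √(h² + τ²) misses. The other comes from the
Jacobian τ/√(h² + τ²), whose defect from 1 has total mass at most h. -/
lemma integral_Ioi_sub_comp_sqrt_le {a : ℝ → ℝ} (ha : Measurable a) {A R : ℝ} (hA : ∀ ρ, |a ρ| ≤ A)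
    (hR : ∀ ρ, R ≤ ρ → a ρ = 0) {h : ℝ} (hh : 0 < h) :
    (∫ ρ in Ioi (0 : ℝ), a ρ) - ∫ τ in Ioi (0 : ℝ), a (√(h ^ 2 + τ ^ 2)) ≤ 2 * A * h := by
  have hA0 : 0 ≤ A := (abs_nonneg _).trans (hA 0)
  set T := max R 0 with hT
  have hT0 : 0 ≤ T := le_max_right _ _
  have hRg : ∀ τ, T < τ → a (√(h ^ 2 + τ ^ 2)) = 0 := fun τ hτ => by
    refine hR _ ((le_max_left R 0).trans (Real.le_sqrt_of_sq_le ?_))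
    nlinarith
  have hgm : Measurable fun τ : ℝ => a (√(h ^ 2 + τ ^ 2)) := ha.comp (by fun_prop)
  have hkm : Measurable fun τ : ℝ => τ / √(h ^ 2 + τ ^ 2) := by fun_prop
  have hia : IntegrableOn a (Ioi 0) := by
    refine integrable_of_bounded_of_support ha hA (A := Iic T) ?_
      fun x hx => hR x ((le_max_left R 0).trans (not_le.1 hx).le)
    rw [Measure.restrict_apply measurableSet_Iic, inter_comm, Ioi_inter_Iic]
    simp
  have hig : IntegrableOn (fun τ : ℝ => a (√(h ^ 2 + τ ^ 2))) (Ioi 0) := by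
    refine integrable_of_bounded_of_support hgm (fun _ => hA _) (A := Iic T) ?_
      fun x hx => hRg x (not_le.1 hx)
    rw [Measure.restrict_apply measurableSet_Iic, inter_comm, Ioi_inter_Iic]
    simp
  have hik : IntegrableOn (fun τ : ℝ => τ / √(h ^ 2 + τ ^ 2) * a (√(h ^ 2 + τ ^ 2))) (Ioi 0) := by
    refine Integrable.bdd_mul hig hkm.aestronglyMeasurable (c := 1)
      ((ae_restrict_iff' measurableSet_Ioi).2 (ae_of_all _ fun τ hτ => ?_))
    have := div_sqrt_mem (h := h) (le_of_lt hτ)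
    rw [Real.norm_eq_abs, abs_of_nonneg this.1]
    exact this.2
  have h1 : ∫ ρ in Ioi (0 : ℝ), a ρ = (∫ ρ in Ioc 0 h, a ρ) + ∫ ρ in Ioi h, a ρ := by
    rw [← setIntegral_union (Ioc_disjoint_Ioi le_rfl) measurableSet_Ioi
      (hia.mono_set Ioc_subset_Ioi_self) (hia.mono_set (Ioi_subset_Ioi hh.le)),
      Ioc_union_Ioi_eq_Ioi hh.le]
  have h2 : ∫ ρ in Ioc 0 h, a ρ ≤ A * h := by
    have := norm_setIntegral_le_of_norm_le_const (μ := volume) (s := Ioc 0 h) (f := a) (C := A)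
      (by simp) fun x _ => hA x
    rw [Real.volume_real_Ioc_of_le hh.le, sub_zero] at this
    exact (le_abs_self _).trans this
  have h3 : (∫ τ in Ioi (0 : ℝ), τ / √(h ^ 2 + τ ^ 2) * a (√(h ^ 2 + τ ^ 2)))
      - ∫ τ in Ioi (0 : ℝ), a (√(h ^ 2 + τ ^ 2)) ≤ A * h := by
    rw [← integral_sub hik hig]
    calc _ = ∫ τ in Ioc 0 T,
          (τ / √(h ^ 2 + τ ^ 2) * a (√(h ^ 2 + τ ^ 2)) - a (√(h ^ 2 + τ ^ 2))) := by
          refine (setIntegral_eq_of_subset_of_forall_sdiff_eq_zero measurableSet_Ioi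
            Ioc_subset_Ioi_self fun τ hτ => ?_)
          have : T < τ := by
            by_contra! hc
            exact hτ.2 ⟨hτ.1, hc⟩
          simp [hRg τ this]
      _ ≤ ∫ τ in Ioc 0 T, A * (1 - τ / √(h ^ 2 + τ ^ 2)) := by
          refine setIntegral_mono_on ((hik.mono_set Ioc_subset_Ioi_self).sub
            (hig.mono_set Ioc_subset_Ioi_self)) ?_ measurableSet_Ioc fun τ hτ => ?_
          · refine Continuous.integrableOn_Ioc ?_
            exact continuous_const.mul (continuous_const.sub
              (continuous_id.div (by fun_prop) fun τ => by positivity))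
          · have hk := div_sqrt_mem (h := h) hτ.1.le
            have hb := abs_le.1 (hA (√(h ^ 2 + τ ^ 2)))
            nlinarith [hk.1, hk.2, hb.1]
      _ = A * ∫ τ in (0 : ℝ)..T, (1 - τ / √(h ^ 2 + τ ^ 2)) := by
          rw [integral_const_mul, intervalIntegral.integral_of_le hT0]
      _ ≤ A * h := mul_le_mul_of_nonneg_left (integral_one_sub_div_sqrt_le hh) hA0
  rw [h1, integral_Ioi_eq_integral_comp_sqrt hh]
  linarith

/-! ### Angular integrals -/

/-- The integral of `C` over the circle of radius `ρ`, with respect to the angle. -/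
noncomputable def circleIntegralAngle (C : Plane → ℝ) (ρ : ℝ) : ℝ :=
  ∫ φ in Ico (-π) π, C (ρ • dir φ)

/-- The angle α is the argument of h + iτ; the point on the line is (h, τ) rotated by φ. -/
lemma exists_polar (h τ : ℝ) :
    ∃ α, ∀ φ, h • dir φ + τ • dirPerp φ = √(h ^ 2 + τ ^ 2) • dir (φ + α) := by
  set z : ℂ := ⟨h, τ⟩ with hz
  have hn : ‖z‖ = √(h ^ 2 + τ ^ 2) := by
    rw [Complex.norm_def, Complex.normSq_apply]
    congr 1
    ring
  have h1 : √(h ^ 2 + τ ^ 2) * Real.cos z.arg = h := hn ▸ Complex.norm_mul_cos_arg z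
  have h2 : √(h ^ 2 + τ ^ 2) * Real.sin z.arg = τ := hn ▸ Complex.norm_mul_sin_arg z
  refine ⟨z.arg, fun φ => ?_⟩
  ext i
  fin_cases i
  · simp only [dir, dirPerp, Real.cos_add, Real.sin_add]
    simp
    linear_combination -Real.cos φ * h1 + Real.sin φ * h2
  · simp only [dir, dirPerp, Real.cos_add, Real.sin_add]
    simp
    linear_combination -Real.sin φ * h1 - Real.cos φ * h2

lemma dir_periodic : Function.Periodic dir (2 * π) := fun φ => by
  simp [dir]

/-- At fixed h and τ the point runs once around a circle as φ varies, and periodicity absorbs the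
initial angle. -/
lemma integral_Ico_line_eq (C : Plane → ℝ) (h τ : ℝ) :
    ∫ φ in Ico (-π) π, C (h • dir φ + τ • dirPerp φ)
      = circleIntegralAngle C (√(h ^ 2 + τ ^ 2)) := by
  obtain ⟨α, hα⟩ := exists_polar h τ
  have hp : Function.Periodic (fun φ => C (√(h ^ 2 + τ ^ 2) • dir φ)) (2 * π) := fun φ => by
    simp only [dir_periodic φ]
  have hπ : -π ≤ π := by linarith [Real.pi_pos]
  have h1 := hp.intervalIntegral_add_eq (-π + α) (-π)
  simp only [hα]
  rw [circleIntegralAngle, integral_Ico_eq_integral_Ioc, integral_Ico_eq_integral_Ioc,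
    ← intervalIntegral.integral_of_le hπ, ← intervalIntegral.integral_of_le hπ,
    intervalIntegral.integral_comp_add_right (fun φ => C (√(h ^ 2 + τ ^ 2) • dir φ))]
  convert h1 using 2 <;> ring

namespace BoundedOnBall

variable {r : ℝ} {F : Plane → ℝ}

lemma measurable_circleIntegralAngle (hF : BoundedOnBall r F) :
    Measurable (circleIntegralAngle F) := by
  have h : Measurable fun p : ℝ × ℝ => F (p.1 • dir p.2) :=
    hF.measurable.comp
      (continuous_fst.smul (continuous_dir.comp continuous_snd)).measurable
  exact (h.stronglyMeasurable.integral_prod_right'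
    (ν := volume.restrict (Ico (-π) π))).measurable

lemma circleIntegralAngle_eq_zero (hF : BoundedOnBall r F) {ρ : ℝ} (hρ : r ≤ ρ) :
    circleIntegralAngle F ρ = 0 := by
  refine integral_eq_zero_of_ae (ae_of_all _ fun φ => hF.eq_zero _ ?_)
  rw [norm_smul, norm_dir, mul_one]
  exact hρ.trans (le_abs_self ρ)

/-- Integrating over angles first leaves an even function of τ, whence the factor 2. -/
lemma integral_radonFun_eq (hF : BoundedOnBall r F) (h : ℝ) :
    ∫ φ in Ico (-π) π, radonFun F (h, φ)
      = 2 * ∫ τ in Ioi (0 : ℝ), circleIntegralAngle F (√(h ^ 2 + τ ^ 2)) := by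
  obtain ⟨B, hB⟩ := hF.bounded
  rw [← integral_comp_abs (f := fun τ => circleIntegralAngle F (√(h ^ 2 + τ ^ 2)))]
  simp only [sq_abs, ← integral_Ico_line_eq]
  refine integral_integral_swap (f := fun φ τ => F (h • dir φ + τ • dirPerp φ)) ?_
  refine integrable_of_bounded_of_support (A := univ ×ˢ Icc (-r) r)
    (hF.measurable_comp_linePoint.comp (by fun_prop : Measurable fun p : ℝ × ℝ => ((h, p.1), p.2)))
    (fun _ => hB _) ?_ ?_
  · rw [Measure.prod_prod]
    exact ENNReal.mul_ne_top (measure_ne_top _ _) (by simp)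
  · rintro ⟨φ, τ⟩ hτ
    refine hF.line_eq_zero_of_right ?_ _ _
    by_contra! hlt
    exact hτ ⟨mem_univ _, abs_le.1 hlt.le⟩

lemma abs_circleIntegralAngle_autocorr_le (hF : BoundedOnBall r F) (ρ : ℝ) :
    |circleIntegralAngle (PixelRadon.autocorr F) ρ| ≤ 2 * π * ∫ x, F x ^ 2 := by
  have h := norm_setIntegral_le_of_norm_le_const (μ := volume) (s := Ico (-π) π)
    (f := fun φ => PixelRadon.autocorr F (ρ • dir φ)) (C := ∫ x, F x ^ 2)
    (by simp) fun φ _ => hF.abs_autocorr_le _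
  rw [Real.volume_real_Ico_of_le (by linarith [Real.pi_pos])] at h
  calc _ ≤ _ := h
    _ = _ := by ring

end BoundedOnBall

/-! ### Energy of the Radon transform and of its increments -/

/-- The measure `ds dφ` on `ℝ × [-π, π[`. -/
noncomputable abbrev cylinderMeasure : Measure (ℝ × ℝ) :=
  (volume : Measure ℝ).prod (volume.restrict (Ico (-π) π))

namespace BoundedOnBall

variable {r : ℝ} {F : Plane → ℝ}

lemma integrable_radonFun_mul (hF : BoundedOnBall r F) (h : ℝ) :
    Integrable (fun z : ℝ × ℝ => radonFun F (z.1 + h, z.2) * radonFun F z) cylinderMeasure := by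
  obtain ⟨B, hB⟩ := hF.exists_radonFun_le
  refine integrable_of_bounded_of_support (B := B * B) (A := Icc (-r) r ×ˢ univ)
    ((hF.measurable_radonFun.comp (by fun_prop)).mul hF.measurable_radonFun) (fun z => ?_) ?_ ?_
  · rw [abs_mul]
    exact mul_le_mul (hB _) (hB _) (abs_nonneg _) ((abs_nonneg _).trans (hB 0))
  · rw [Measure.prod_prod]
    exact ENNReal.mul_ne_top (by simp) (measure_ne_top _ _)
  · rintro ⟨s, φ⟩ hs
    have : r ≤ |s| := by
      by_contra! hlt
      exact hs ⟨abs_le.1 hlt.le, mem_univ _⟩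
    simp [hF.radonFun_eq_zero this φ]

lemma integral_radonFun_mul (hF : BoundedOnBall r F) (h : ℝ) :
    ∫ z, radonFun F (z.1 + h, z.2) * radonFun F z ∂cylinderMeasure
      = 2 * ∫ τ in Ioi (0 : ℝ), circleIntegralAngle (PixelRadon.autocorr F) (√(h ^ 2 + τ ^ 2)) := by
  rw [integral_prod_symm _ (hF.integrable_radonFun_mul h), ← hF.autocorr.integral_radonFun_eq]
  simp only [hF.radonFun_autocorr]

lemma integral_radonFun_sq_eq (hF : BoundedOnBall r F) :
    ∫ z, radonFun F z ^ 2 ∂cylinderMeasure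
      = 2 * ∫ ρ in Ioi (0 : ℝ), circleIntegralAngle (PixelRadon.autocorr F) ρ := by
  have h := hF.integral_radonFun_mul 0
  simp only [add_zero, Prod.mk.eta, ← pow_two] at h
  rw [h]
  congr 1
  refine setIntegral_congr_fun measurableSet_Ioi fun τ hτ => ?_
  simp only [ne_eq, OfNat.ofNat_ne_zero, not_false_eq_true, zero_pow, zero_add]
  rw [Real.sqrt_sq (le_of_lt hτ)]

lemma integrable_radonFun_sq (hF : BoundedOnBall r F) :
    Integrable (fun z : ℝ × ℝ => radonFun F z ^ 2) cylinderMeasure := by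
  simpa [pow_two] using hF.integrable_radonFun_mul 0

lemma measurePreserving_shift (h : ℝ) :
    MeasurePreserving (fun z : ℝ × ℝ => (z.1 + h, z.2)) cylinderMeasure cylinderMeasure :=
  (measurePreserving_add_right volume h).prod (MeasurePreserving.id _)

lemma integral_shift {G : ℝ × ℝ → ℝ} (hG : Measurable G) (h : ℝ) :
    ∫ z, G (z.1 + h, z.2) ∂cylinderMeasure = ∫ z, G z ∂cylinderMeasure := by
  have hm := measurePreserving_shift h
  nth_rewrite 2 [← hm.map_eq]
  rw [integral_map hm.measurable.aemeasurable hG.aestronglyMeasurable]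

/-- The shift preserves the measure. The circular integrals of the autocorrelation vanish beyond 2r
and are at most 2π∫F², which gives 2 · 2r · 2π. -/
lemma integral_radonFun_shift_sq_le (hF : BoundedOnBall r F) (hr : 0 ≤ r) (h : ℝ) :
    ∫ z, radonFun F (z.1 + h, z.2) ^ 2 ∂cylinderMeasure ≤ 8 * π * r * ∫ x, F x ^ 2 := by
  rw [integral_shift (G := fun z => radonFun F z ^ 2) (hF.measurable_radonFun.pow_const 2) h,
    hF.integral_radonFun_sq_eq, setIntegral_eq_of_subset_of_forall_sdiff_eq_zero
      measurableSet_Ioi (show Ioc (0 : ℝ) (2 * r) ⊆ Ioi 0 from Ioc_subset_Ioi_self) fun ρ hρ =>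
      hF.autocorr.circleIntegralAngle_eq_zero (by
        by_contra! hlt
        exact hρ.2 ⟨hρ.1, hlt.le⟩)]
  have := norm_setIntegral_le_of_norm_le_const (μ := volume) (s := Ioc 0 (2 * r))
    (f := circleIntegralAngle (PixelRadon.autocorr F)) measure_Ioc_lt_top fun ρ _ => hF.abs_circleIntegralAngle_autocorr_le ρ
  rw [Real.volume_real_Ioc_of_le (by linarith)] at this
  have h2 := (le_abs_self _).trans this
  linarith

/-- Expanding the square leaves twice the correlation at lag 0 minus twice that at lag h. The
one-dimensional comparison with A = 2π∫F² then gives 4 · 2A|h|. -/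
lemma integral_radonFun_increment_sq_le (hF : BoundedOnBall r F) (h : ℝ) :
    ∫ z, (radonFun F (z.1 + h, z.2) - radonFun F z) ^ 2 ∂cylinderMeasure
      ≤ 16 * π * |h| * ∫ x, F x ^ 2 := by
  have h1 : ∫ z, (radonFun F (z.1 + h, z.2) - radonFun F z) ^ 2 ∂cylinderMeasure
      = 2 * (∫ z, radonFun F z ^ 2 ∂cylinderMeasure)
        - 2 * ∫ z, radonFun F (z.1 + h, z.2) * radonFun F z ∂cylinderMeasure := by
    have he : ∀ z : ℝ × ℝ, (radonFun F (z.1 + h, z.2) - radonFun F z) ^ 2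
        = radonFun F (z.1 + h, z.2) ^ 2 + radonFun F z ^ 2
          - 2 * (radonFun F (z.1 + h, z.2) * radonFun F z) := fun z => by ring
    have hi1 : Integrable (fun z : ℝ × ℝ => radonFun F (z.1 + h, z.2) ^ 2) cylinderMeasure :=
      (measurePreserving_shift h).integrable_comp_of_integrable hF.integrable_radonFun_sq
    have hi2 : Integrable (fun z : ℝ × ℝ => radonFun F (z.1 + h, z.2) ^ 2 + radonFun F z ^ 2)
      cylinderMeasure := hi1.add hF.integrable_radonFun_sq
    simp only [he]
    rw [integral_sub hi2 ((hF.integrable_radonFun_mul h).const_mul 2),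
      integral_add hi1 hF.integrable_radonFun_sq, integral_const_mul,
      integral_shift (G := fun z => radonFun F z ^ 2) (hF.measurable_radonFun.pow_const 2) h]
    ring
  rw [h1, hF.integral_radonFun_mul, hF.integral_radonFun_sq_eq]
  -- The comparison of integrals needs a positive lag; at lag 0 both sides vanish.
  rcases eq_or_ne h 0 with rfl | hh
  · have : ∫ τ in Ioi (0 : ℝ), circleIntegralAngle (PixelRadon.autocorr F) (√(0 ^ 2 + τ ^ 2))
        = ∫ τ in Ioi (0 : ℝ), circleIntegralAngle (PixelRadon.autocorr F) τ := by
      refine setIntegral_congr_fun measurableSet_Ioi fun τ hτ => ?_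
      simp only [ne_eq, OfNat.ofNat_ne_zero, not_false_eq_true, zero_pow, zero_add]
      rw [Real.sqrt_sq (le_of_lt hτ)]
    rw [this]
    simp
  · have := integral_Ioi_sub_comp_sqrt_le hF.autocorr.measurable_circleIntegralAngle
      hF.abs_circleIntegralAngle_autocorr_le
      (fun ρ hρ => hF.autocorr.circleIntegralAngle_eq_zero hρ) (abs_pos.2 hh)
    simp only [sq_abs] at this
    linarith

end BoundedOnBall

/-! ### The hat function -/

lemma hat_nonneg (δ t : ℝ) : 0 ≤ hat δ t := le_max_left _ _

lemma hat_eq_zero {δ t : ℝ} (h : δ ≤ |t|) : hat δ t = 0 := max_eq_left (by linarith)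

lemma hat_le {δ : ℝ} (hδ : 0 ≤ δ) (t : ℝ) : hat δ t ≤ δ :=
  max_le hδ (by linarith [abs_nonneg t])

lemma abs_hat_sub_le (δ a b : ℝ) : |hat δ a - hat δ b| ≤ |a - b| := by
  have h := abs_max_sub_max_le_max 0 (δ - |a|) 0 (δ - |b|)
  rw [sub_self, abs_zero, max_eq_right (abs_nonneg (δ - |a| - (δ - |b|)))] at h
  refine h.trans ?_
  rw [sub_sub_sub_cancel_left, abs_sub_comm a b]
  exact abs_abs_sub_abs_le b a

lemma continuous_hat (δ : ℝ) : Continuous (hat δ) := by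
  unfold hat
  fun_prop

lemma integral_hat {δ : ℝ} (hδ : 0 < δ) : ∫ t, hat δ t = δ ^ 2 := by
  have h1 : ∫ t, hat δ t = 2 * ∫ t in Ioi (0 : ℝ), max 0 (δ - t) :=
    integral_comp_abs (f := fun t => max 0 (δ - t))
  have h2 : ∫ t in Ioi (0 : ℝ), max 0 (δ - t) = ∫ t in Ioc 0 δ, (δ - t) := by
    rw [setIntegral_eq_of_subset_of_forall_sdiff_eq_zero measurableSet_Ioi
      (show Ioc (0 : ℝ) δ ⊆ Ioi 0 from Ioc_subset_Ioi_self) fun t ht => max_eq_left ?_]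
    · exact setIntegral_congr_fun measurableSet_Ioc fun t ht => max_eq_right (by linarith [ht.2])
    · by_contra! h
      exact ht.2 ⟨ht.1, by linarith⟩
  rw [h1, h2, ← intervalIntegral.integral_of_le hδ.le, intervalIntegral.integral_sub
    (by simp) (by simp), integral_id]
  simp
  ring

/-! ### Geometry of the pixels -/

lemma norm_dir_sub_le (a b : ℝ) : ‖dir a - dir b‖ ≤ |a - b| := by
  rw [← abs_of_nonneg (norm_nonneg (dir a - dir b)), ← sq_le_sq, EuclideanSpace.norm_sq_eq]
  simp [dir, Fin.sum_univ_two]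
  -- The squared chord is 2 − 2cos(a − b).
  have h := Real.one_sub_sq_div_two_le_cos (x := a - b)
  rw [Real.cos_sub] at h
  nlinarith [Real.sin_sq_add_cos_sq a, Real.sin_sq_add_cos_sq b]

namespace Discretization

variable (D : Discretization)

lemma φ_le_of_le {q q' : ℕ} (h1 : q ≤ q') (h2 : q' ≤ D.Q + 1) : D.φ q ≤ D.φ q' := by
  induction q', h1 using Nat.le_induction with
  | base => exact le_rfl
  | succ n hn ih =>
    refine (ih (by omega)).trans ?_
    rcases Nat.eq_zero_or_pos n with rfl | h0
    · rw [D.φ_zero, zero_add]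
      linarith [(D.φ_mem D.Q D.one_le_Q le_rfl).2, (D.φ_mem 1 le_rfl D.one_le_Q).1]
    · rcases (show n < D.Q ∨ n = D.Q by omega) with h | rfl
      · exact (D.φ_lt n h0 h).le
      · rw [D.φ_succ]
        linarith [(D.φ_mem D.Q D.one_le_Q le_rfl).2, (D.φ_mem 1 le_rfl D.one_le_Q).1]

lemma φ_succ_sub_le {q : ℕ} (h : q ≤ D.Q) : D.φ (q + 1) - D.φ q ≤ D.δφ := by
  rcases Nat.eq_zero_or_pos q with rfl | h0
  -- The gap before the first angle is the periodic copy of the gap after the last one, which the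
  -- maximum already includes.
  · have : D.φ (0 + 1) - D.φ 0 = D.φ (D.Q + 1) - D.φ D.Q := by
      rw [D.φ_succ, D.φ_zero]
      ring
    rw [this]
    exact Finset.le_sup' (fun q => D.φ (q + 1) - D.φ q) (Finset.mem_Icc.2 ⟨D.one_le_Q, le_rfl⟩)
  · exact Finset.le_sup' (fun q => D.φ (q + 1) - D.φ q) (Finset.mem_Icc.2 ⟨h0, h⟩)

lemma δφ_nonneg : 0 ≤ D.δφ :=
  (sub_nonneg.2 (D.φ_le_of_le (Nat.le_succ D.Q) le_rfl)).trans (D.φ_succ_sub_le le_rfl)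

lemma norm_dir_sub_le_δφ {q : ℕ} (hq : q ∈ Finset.Icc 1 D.Q) {φ : ℝ} (hφ : φ ∈ D.Φ q) :
    ‖dir (D.φ q) - dir φ‖ ≤ D.δφ := by
  obtain ⟨k, hk1, hk2⟩ := hφ
  obtain ⟨h1, h2⟩ := Finset.mem_Icc.1 hq
  have hk : dir (φ + k * (2 * π)) = dir φ := dir_periodic.int_mul k φ
  rw [← hk]
  refine (norm_dir_sub_le _ _).trans ?_
  have ha := D.φ_succ_sub_le h2
  have hb := D.φ_succ_sub_le (show q - 1 ≤ D.Q by omega)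
  rw [Nat.sub_add_cancel h1] at hb
  have := D.δφ_nonneg
  rw [abs_le]
  constructor <;> linarith

lemma eq_of_mem_S {p p' : ℕ} {t : ℝ} (h : t ∈ D.S p) (h' : t ∈ D.S p') : p = p' := by
  have hδ := D.δs_pos
  simp only [S, s, mem_Ico] at h h'
  have h1 : (p : ℝ) < p' + 1 := by nlinarith
  have h2 : (p' : ℝ) < p + 1 := by nlinarith
  norm_cast at h1 h2
  omega

/-- The unwrapped pixels are consecutive half-open intervals filling exactly one period: first the
multiples of 2π agree, then the indices. -/
lemma eq_of_mem_Φ {q q' : ℕ} (hq : q ∈ Finset.Icc 1 D.Q) (hq' : q' ∈ Finset.Icc 1 D.Q) {φ : ℝ}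
    (h : φ ∈ D.Φ q) (h' : φ ∈ D.Φ q') : q = q' := by
  have key : ∀ a b : ℕ, 1 ≤ a → a ≤ b → b ≤ D.Q + 1 →
      (D.φ (a - 1) + D.φ a) / 2 ≤ (D.φ (b - 1) + D.φ b) / 2 := fun a b ha hab hb => by
    linarith [D.φ_le_of_le (show a - 1 ≤ b - 1 by omega) (by omega), D.φ_le_of_le hab hb]
  have hwrap : (D.φ D.Q + D.φ (D.Q + 1)) / 2 = (D.φ 0 + D.φ 1) / 2 + 2 * π := by
    rw [D.φ_succ, D.φ_zero]
    ring
  obtain ⟨k, hk1, hk2⟩ := h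
  obtain ⟨k', hk1', hk2'⟩ := h'
  rw [Finset.mem_Icc] at hq hq'
  have e1 := key 1 q le_rfl hq.1 (by omega)
  have e2 := key (q + 1) (D.Q + 1) (by omega) (by omega) le_rfl
  have e1' := key 1 q' le_rfl hq'.1 (by omega)
  have e2' := key (q' + 1) (D.Q + 1) (by omega) (by omega) le_rfl
  simp only [Nat.add_sub_cancel, Nat.sub_self] at e1 e2 e1' e2'
  have hπ := Real.pi_pos
  have hkk : k = k' := by
    have h1 : (k : ℝ) < k' + 1 := by nlinarith
    have h2 : (k' : ℝ) < k + 1 := by nlinarith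
    norm_cast at h1 h2
    omega
  subst hkk
  rcases lt_trichotomy q q' with hlt | heq | hlt
  · have := key (q + 1) q' (by omega) hlt (by omega)
    simp only [Nat.add_sub_cancel] at this
    linarith
  · exact heq
  · have := key (q' + 1) q (by omega) hlt (by omega)
    simp only [Nat.add_sub_cancel] at this
    linarith

lemma eq_of_mem_X {i j i' j' : ℕ} {y : Plane} (h : y ∈ D.X i j) (h' : y ∈ D.X i' j') :
    i = i' ∧ j = j' := by
  have hδ := D.δx_pos
  have a0 := h 0
  have a1 := h 1
  have b0 := h' 0
  have b1 := h' 1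
  simp only [x, mem_Ico, Matrix.cons_val_zero, Matrix.cons_val_one, PiLp.toLp_apply]
    at a0 a1 b0 b1
  constructor
  · have h1 : (i : ℝ) < i' + 1 := by nlinarith
    have h2 : (i' : ℝ) < i + 1 := by nlinarith
    norm_cast at h1 h2
    omega
  · have h1 : (j : ℝ) < j' + 1 := by nlinarith
    have h2 : (j' : ℝ) < j + 1 := by nlinarith
    norm_cast at h1 h2
    omega

/-- Half the diagonal of a pixel is δx/√2. -/
lemma norm_sub_le_of_mem_X {i j : ℕ} {y : Plane} (h : y ∈ D.X i j) : ‖D.x i j - y‖ ≤ D.δx := by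
  have hδ := D.δx_pos
  have a0 := h 0
  have a1 := h 1
  rw [mem_Ico] at a0 a1
  rw [← abs_of_nonneg (norm_nonneg (D.x i j - y)), ← abs_of_pos hδ, ← sq_le_sq,
    EuclideanSpace.norm_sq_eq]
  simp only [Fin.sum_univ_two, PiLp.sub_apply, Real.norm_eq_abs, sq_abs]
  nlinarith

lemma abs_inner_sub_inner_le {i j q : ℕ} (hq : q ∈ Finset.Icc 1 D.Q) {φ : ℝ} (hφ : φ ∈ D.Φ q)
    {y : Plane} (hy : y ∈ D.X i j) (hy1 : ‖y‖ ≤ 1) :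
    |⟪D.x i j, dir (D.φ q)⟫ - ⟪y, dir φ⟫| ≤ D.δx + D.δφ := by
  have h : ⟪D.x i j, dir (D.φ q)⟫ - ⟪y, dir φ⟫
      = ⟪D.x i j - y, dir (D.φ q)⟫ + ⟪y, dir (D.φ q) - dir φ⟫ := by
    rw [inner_sub_left, inner_sub_right]
    ring
  have h1 := abs_real_inner_le_norm (D.x i j - y) (dir (D.φ q))
  have h2 := abs_real_inner_le_norm y (dir (D.φ q) - dir φ)
  rw [norm_dir, mul_one] at h1
  have h3 := mul_le_mul hy1 (D.norm_dir_sub_le_δφ hq hφ) (norm_nonneg _) zero_le_one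
  rw [h]
  linarith [abs_add_le ⟪D.x i j - y, dir (D.φ q)⟫ ⟪y, dir (D.φ q) - dir φ⟫,
    D.norm_sub_le_of_mem_X hy]

/-- The index set of the image pixels. -/
def pixels : Finset (ℕ × ℕ) := Finset.Icc 1 D.N ×ˢ Finset.Icc 1 D.M

variable {D}

lemma integral_eq_sum_pixels (hD : D.Compatible) {G : Plane → ℝ} (hG : Integrable G)
    (h0 : ∀ y, y ∉ Ω → G y = 0) :
    ∫ y, G y = ∑ ij ∈ D.pixels, ∫ y in D.X ij.1 ij.2, G y := by
  rw [← integral_biUnion_finset _ (fun ij _ => measurableSet_X D ij.1 ij.2) ?_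
    fun _ _ => hG.integrableOn]
  · refine (setIntegral_eq_integral_of_forall_compl_eq_zero fun y hy => h0 y fun hyΩ => hy ?_).symm
    have := hD.1 hyΩ
    simp only [mem_iUnion] at this
    obtain ⟨i, hi, j, hj, hij⟩ := this
    simp only [mem_iUnion]
    exact ⟨(i, j), Finset.mem_product.2 ⟨hi, hj⟩, hij⟩
  · rintro ⟨i, j⟩ - ⟨i', j'⟩ - hne
    refine disjoint_left.2 fun y h h' => hne ?_
    obtain ⟨rfl, rfl⟩ := D.eq_of_mem_X h h'
    rfl

/-- Disjointness of the sinogram pixels leaves a single term, and the factor δx² cancels the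
normalization of the pixel values. -/
lemma discreteRadonFun_eq {F : Plane → ℝ} {p q : ℕ} (hp : p ∈ Finset.Icc 1 D.P)
    (hq : q ∈ Finset.Icc 1 D.Q) {z : ℝ × ℝ} (hz1 : z.1 ∈ D.S p) (hz2 : z.2 ∈ D.Φ q) :
    discreteRadonFun D F z = (D.δs ^ 2)⁻¹ * ∑ ij ∈ D.pixels,
      hat D.δs (⟪D.x ij.1 ij.2, dir (D.φ q)⟫ - D.s p) * ∫ y in D.X ij.1 ij.2, F y := by
  have hx := D.δx_pos.ne'
  have hs := D.δs_pos.ne'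
  rw [discreteRadonFun, Finset.sum_eq_single_of_mem p hp, Finset.sum_eq_single_of_mem q hq]
  · rw [indicator_of_mem hz1, indicator_of_mem hz2, pixels, Finset.sum_product]
    simp only [Pi.one_apply, one_mul, pixelValue, Finset.mul_sum]
    refine Finset.sum_congr rfl fun i _ => Finset.sum_congr rfl fun j _ => ?_
    field_simp
  · intro q' hq' hne
    rw [indicator_of_notMem (s := D.Φ q') fun h => hne (D.eq_of_mem_Φ hq' hq h hz2)]
    simp
  · intro p' hp' hne
    refine Finset.sum_eq_zero fun q' _ => ?_
    rw [indicator_of_notMem (s := D.S p') fun h => hne (D.eq_of_mem_S h hz1)]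
    simp

/-! ### Pointwise comparison -/

lemma abs_discreteRadonFun_sub_ridge_le (hD : D.Compatible) (hη : D.δx + D.δφ ≤ D.δs)
    {F : Plane → ℝ} (hF : BoundedOnBall 1 F) {p q : ℕ} (hp : p ∈ Finset.Icc 1 D.P)
    (hq : q ∈ Finset.Icc 1 D.Q) {z : ℝ × ℝ} (hz1 : z.1 ∈ D.S p) (hz2 : z.2 ∈ D.Φ q) :
    |discreteRadonFun D F z - (D.δs ^ 2)⁻¹ * ∫ y, hat D.δs (⟪y, dir z.2⟫ - D.s p) * F y|
      ≤ (D.δx + D.δφ) / D.δs ^ 2 * ∫ h in Icc (-(5 / 2 * D.δs)) (5 / 2 * D.δs),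
        radonFun (fun y => |F y|) (z.1 + h, z.2) := by
  have hδ := D.δs_pos
  set η := D.δx + D.δφ with hηdef
  have hη0 : 0 ≤ η := add_nonneg D.δx_pos.le D.δφ_nonneg
  -- Outside this window both hats vanish: 5/2 = 1/2 + 1 + 1, for the distance from s to s_p, the
  -- perturbation η ≤ δs and the support of the hat.
  set A : Set ℝ := {v | |v - z.1| ≤ 5 / 2 * D.δs} with hA
  have hAm : MeasurableSet A := measurableSet_le (by fun_prop) measurable_const
  have hF0 : ∀ y, y ∉ Ω → F y = 0 := fun y hy => hF.eq_zero y (by simpa [Ω] using hy)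
  have hψm : Measurable (A.indicator (1 : ℝ → ℝ)) := measurable_one.indicator hAm
  have hψb : ∀ v, |A.indicator (1 : ℝ → ℝ) v| ≤ 1 := fun v => by
    by_cases hv : v ∈ A <;> simp [hv]
  have hhm : Measurable fun y : Plane => hat D.δs (⟪y, dir z.2⟫ - D.s p) :=
    ((continuous_hat _).comp (by fun_prop)).measurable
  have hi1 : Integrable fun y => hat D.δs (⟪y, dir z.2⟫ - D.s p) * F y :=
    hF.integrable.bdd_mul hhm.aestronglyMeasurable (c := D.δs) (ae_of_all _ fun y => by
      rw [Real.norm_eq_abs, abs_of_nonneg (hat_nonneg _ _)]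
      exact hat_le hδ.le _)
  have hi2 : Integrable fun y => A.indicator (1 : ℝ → ℝ) ⟪y, dir z.2⟫ * |F y| :=
    hF.abs.integrable.bdd_mul (hψm.comp (by fun_prop)).aestronglyMeasurable
      (ae_of_all _ fun y => hψb _)
  have hint : ∫ y, A.indicator (1 : ℝ → ℝ) ⟪y, dir z.2⟫ * |F y|
      = ∫ h in Icc (-(5 / 2 * D.δs)) (5 / 2 * D.δs),
        radonFun (fun y => |F y|) (z.1 + h, z.2) := by
    rw [hF.abs.integral_ridge_mul hψm hψb, ← integral_add_left_eq_self _ z.1,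
      ← integral_indicator measurableSet_Icc]
    congr 1
    ext h
    have : z.1 + h ∈ A ↔ h ∈ Icc (-(5 / 2 * D.δs)) (5 / 2 * D.δs) := by
      rw [hA, mem_ofPred_eq, add_sub_cancel_left, abs_le, mem_Icc]
    by_cases hh : h ∈ Icc (-(5 / 2 * D.δs)) (5 / 2 * D.δs)
    · rw [indicator_of_mem hh, indicator_of_mem (this.2 hh), Pi.one_apply, one_mul]
    · rw [indicator_of_notMem hh, indicator_of_notMem (mt this.1 hh), zero_mul]
  have hpt : ∀ ij ∈ D.pixels, ∀ y ∈ D.X ij.1 ij.2,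
      ‖hat D.δs (⟪D.x ij.1 ij.2, dir (D.φ q)⟫ - D.s p) * F y
        - hat D.δs (⟪y, dir z.2⟫ - D.s p) * F y‖
      ≤ η * (A.indicator (1 : ℝ → ℝ) ⟪y, dir z.2⟫ * |F y|) := by
    intro ij _ y hy
    rw [← sub_mul, norm_mul, Real.norm_eq_abs, Real.norm_eq_abs, ← mul_assoc]
    by_cases hyΩ : y ∈ Ω
    swap
    · simp [hF0 y hyΩ]
    refine mul_le_mul_of_nonneg_right ?_ (abs_nonneg _)
    have hy1 : ‖y‖ ≤ 1 := (mem_ball_zero_iff.1 hyΩ).le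
    have h1 := D.abs_inner_sub_inner_le hq hz2 hy hy1
    by_cases hv : ⟪y, dir z.2⟫ ∈ A
    · rw [indicator_of_mem hv, Pi.one_apply, mul_one]
      refine (abs_hat_sub_le _ _ _).trans ?_
      rwa [sub_sub_sub_cancel_right]
    · have hv' : 5 / 2 * D.δs < |⟪y, dir z.2⟫ - z.1| := not_le.1 hv
      have hsp : |z.1 - D.s p| ≤ D.δs / 2 := by
        rw [abs_le]
        constructor <;> linarith [hz1.1, hz1.2]
      have h2 : 2 * D.δs ≤ |⟪y, dir z.2⟫ - D.s p| := by
        have := abs_sub_le ⟪y, dir z.2⟫ (D.s p) z.1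
        rw [abs_sub_comm (D.s p)] at this
        linarith
      have h3 : D.δs ≤ |⟪D.x ij.1 ij.2, dir (D.φ q)⟫ - D.s p| := by
        have := abs_sub_le ⟪y, dir z.2⟫ ⟪D.x ij.1 ij.2, dir (D.φ q)⟫ (D.s p)
        rw [abs_sub_comm ⟪y, dir z.2⟫ ⟪D.x ij.1 ij.2, dir (D.φ q)⟫] at this
        linarith
      rw [hat_eq_zero h3, hat_eq_zero (show D.δs ≤ _ by linarith)]
      simp [indicator_of_notMem hv]
  rw [discreteRadonFun_eq hp hq hz1 hz2, ← mul_sub, abs_mul, abs_of_pos (by positivity),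
    integral_eq_sum_pixels hD hi1 fun y hy => by rw [hF0 y hy, mul_zero],
    ← Finset.sum_sub_distrib, div_eq_inv_mul, mul_assoc]
  refine mul_le_mul_of_nonneg_left ?_ (by positivity)
  rw [← hint, ← integral_const_mul, integral_eq_sum_pixels hD (hi2.const_mul η) fun y hy => by
    rw [hF0 y hy, abs_zero, mul_zero, mul_zero]]
  refine (Finset.abs_sum_le_sum_abs _ _).trans (Finset.sum_le_sum fun ij hij => ?_)
  rw [← integral_const_mul, ← integral_sub (hF.integrable.const_mul _).integrableOn
    hi1.integrableOn]
  exact (norm_integral_le_integral_norm _).trans (setIntegral_mono_on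
    ((hF.integrable.const_mul _).sub hi1).norm.integrableOn (hi2.const_mul η).integrableOn
    (measurableSet_X D _ _) (hpt ij hij))

/-- Since the hat has integral δs², the value at z can be moved inside the average. The hat is at
most δs and, seen from s, is supported in |h| ≤ (1 + 1/2)δs. -/
lemma abs_ridge_sub_radonFun_le {F : Plane → ℝ} (hF : BoundedOnBall 1 F) {p : ℕ} {z : ℝ × ℝ}
    (hz1 : z.1 ∈ D.S p) :
    |(D.δs ^ 2)⁻¹ * (∫ y, hat D.δs (⟪y, dir z.2⟫ - D.s p) * F y) - radonFun F z|
      ≤ D.δs⁻¹ * ∫ h in Icc (-(3 / 2 * D.δs)) (3 / 2 * D.δs),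
        |radonFun F (z.1 + h, z.2) - radonFun F z| := by
  have hδ := D.δs_pos
  obtain ⟨B, hB⟩ := hF.exists_radonFun_le
  have hb : ∀ t, |hat D.δs t| ≤ D.δs := fun t => by
    rw [abs_of_nonneg (hat_nonneg _ _)]
    exact hat_le hδ.le _
  have hsupp : ∀ h, h ∉ Icc (-(3 / 2 * D.δs)) (3 / 2 * D.δs) → hat D.δs (z.1 + h - D.s p) = 0 := by
    intro h hh
    refine hat_eq_zero ?_
    by_contra! hlt
    rw [abs_lt] at hlt
    exact hh ⟨by linarith [hz1.1, hz1.2], by linarith [hz1.1, hz1.2]⟩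
  have hm1 : Measurable fun h => hat D.δs (z.1 + h - D.s p) :=
    ((continuous_hat _).comp (by fun_prop)).measurable
  have hm2 : Measurable fun h => radonFun F (z.1 + h, z.2) :=
    hF.measurable_radonFun.comp (by fun_prop)
  have hi1 : Integrable fun h => hat D.δs (z.1 + h - D.s p) :=
    integrable_of_bounded_of_support hm1 (fun h => hb _) (by simp) hsupp
  have hi2 : Integrable fun h => hat D.δs (z.1 + h - D.s p) * radonFun F (z.1 + h, z.2) :=
    hi1.mul_bdd hm2.aestronglyMeasurable (ae_of_all _ fun h => hB _)
  have e1 : ∫ y, hat D.δs (⟪y, dir z.2⟫ - D.s p) * F y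
      = ∫ h, hat D.δs (z.1 + h - D.s p) * radonFun F (z.1 + h, z.2) := by
    rw [hF.integral_ridge_mul (ψ := fun v => hat D.δs (v - D.s p))
      ((continuous_hat _).comp (by fun_prop)).measurable (fun v => hb _),
      ← integral_add_left_eq_self _ z.1]
  have e2 : ∫ h, hat D.δs (z.1 + h - D.s p) * radonFun F z = D.δs ^ 2 * radonFun F z := by
    rw [integral_mul_const, ← integral_hat hδ]
    congr 1
    rw [← integral_add_left_eq_self (hat D.δs) (z.1 - D.s p)]
    congr 1
    ext h
    congr 1
    ring
  have e3 : (D.δs ^ 2)⁻¹ * (∫ y, hat D.δs (⟪y, dir z.2⟫ - D.s p) * F y) - radonFun F z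
      = (D.δs ^ 2)⁻¹ * ∫ h in Icc (-(3 / 2 * D.δs)) (3 / 2 * D.δs),
        hat D.δs (z.1 + h - D.s p) * (radonFun F (z.1 + h, z.2) - radonFun F z) := by
    rw [setIntegral_eq_integral_of_forall_compl_eq_zero fun h hh => by rw [hsupp h hh, zero_mul]]
    simp only [mul_sub]
    rw [integral_sub hi2 (hi1.mul_const _), e1, e2]
    field_simp
  rw [e3, abs_mul, abs_of_pos (by positivity), pow_two, mul_inv, mul_assoc]
  refine mul_le_mul_of_nonneg_left ?_ (by positivity)
  rw [inv_mul_le_iff₀ hδ, ← integral_const_mul]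
  have hfin : Integrable (fun h => radonFun F (z.1 + h, z.2) - radonFun F z)
      (volume.restrict (Icc (-(3 / 2 * D.δs)) (3 / 2 * D.δs))) :=
    (Integrable.of_bound hm2.aestronglyMeasurable B (ae_of_all _ fun h => hB _)).sub
      (integrable_const _)
  refine (norm_integral_le_integral_norm _).trans (integral_mono_of_nonneg
    (ae_of_all _ fun h => norm_nonneg (hat D.δs (z.1 + h - D.s p) *
      (radonFun F (z.1 + h, z.2) - radonFun F z))) (hfin.abs.const_mul _) (ae_of_all _ fun h => ?_))
  simp only [norm_mul, Real.norm_eq_abs]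
  exact mul_le_mul_of_nonneg_right (hb _) (abs_nonneg _)

lemma sq_discreteRadonFun_sub_radonFun_le (hD : D.Compatible) (hη : D.δx + D.δφ ≤ D.δs)
    {F : Plane → ℝ} (hF : BoundedOnBall 1 F) {z : ℝ × ℝ} (hz : z ∈ Ω') :
    (discreteRadonFun D F z - radonFun F z) ^ 2
      ≤ 10 * (D.δx + D.δφ) ^ 2 / D.δs ^ 3 * (∫ h in Icc (-(5 / 2 * D.δs)) (5 / 2 * D.δs),
          radonFun (fun y => |F y|) (z.1 + h, z.2) ^ 2)
        + 6 / D.δs * ∫ h in Icc (-(3 / 2 * D.δs)) (3 / 2 * D.δs),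
          (radonFun F (z.1 + h, z.2) - radonFun F z) ^ 2 := by
  have hδ := D.δs_pos
  have hmem := hD.2 hz
  simp only [mem_iUnion] at hmem
  obtain ⟨p, hp, q, hq, hz1, hz2⟩ := hmem
  obtain ⟨B, hB⟩ := hF.exists_radonFun_le
  obtain ⟨B', hB'⟩ := hF.abs.exists_radonFun_le
  have h1 := abs_discreteRadonFun_sub_ridge_le hD hη hF hp hq hz1 hz2
  have h2 := abs_ridge_sub_radonFun_le (D := D) hF hz1
  set m := (D.δs ^ 2)⁻¹ * ∫ y, hat D.δs (⟪y, dir z.2⟫ - D.s p) * F y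
  have c1 := sq_setIntegral_Icc_le (g := fun h => radonFun (fun y => |F y|) (z.1 + h, z.2))
    (hF.abs.measurable_radonFun.comp (by fun_prop)) (fun _ => hB' _)
    (show -(5 / 2 * D.δs) < 5 / 2 * D.δs by linarith)
  have c2 := sq_setIntegral_Icc_le (g := fun h => |radonFun F (z.1 + h, z.2) - radonFun F z|)
    (B := B + B)
    (((hF.measurable_radonFun.comp (by fun_prop)).sub_const _).abs)
    (fun h => by
      rw [abs_abs]
      exact (abs_sub _ _).trans (add_le_add (hB _) (hB _)))
    (show -(3 / 2 * D.δs) < 3 / 2 * D.δs by linarith)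
  simp only [sq_abs] at c2
  set I1 := ∫ h in Icc (-(5 / 2 * D.δs)) (5 / 2 * D.δs), radonFun (fun y => |F y|) (z.1 + h, z.2)
  set J1 := ∫ h in Icc (-(5 / 2 * D.δs)) (5 / 2 * D.δs),
    radonFun (fun y => |F y|) (z.1 + h, z.2) ^ 2
  set I2 := ∫ h in Icc (-(3 / 2 * D.δs)) (3 / 2 * D.δs),
    |radonFun F (z.1 + h, z.2) - radonFun F z|
  set J2 := ∫ h in Icc (-(3 / 2 * D.δs)) (3 / 2 * D.δs),
    (radonFun F (z.1 + h, z.2) - radonFun F z) ^ 2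
  -- Cauchy–Schwarz contributes the window length 5δs, and 3δs in `s2` below; (a + b)² ≤ 2a² + 2b²
  -- then doubles both constants.
  have s1 : (discreteRadonFun D F z - m) ^ 2 ≤ 5 * (D.δx + D.δφ) ^ 2 / D.δs ^ 3 * J1 := by
    calc _ ≤ ((D.δx + D.δφ) / D.δs ^ 2 * I1) ^ 2 := by
          rw [← sq_abs]
          exact pow_le_pow_left₀ (abs_nonneg _) h1 2
      _ = (D.δx + D.δφ) ^ 2 / D.δs ^ 4 * I1 ^ 2 := by ring
      _ ≤ (D.δx + D.δφ) ^ 2 / D.δs ^ 4 * ((5 / 2 * D.δs - -(5 / 2 * D.δs)) * J1) :=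
          mul_le_mul_of_nonneg_left c1 (by positivity)
      _ = _ := by
          field_simp
          ring
  have s2 : (m - radonFun F z) ^ 2 ≤ 3 / D.δs * J2 := by
    calc _ ≤ (D.δs⁻¹ * I2) ^ 2 := by
          rw [← sq_abs]
          exact pow_le_pow_left₀ (abs_nonneg _) h2 2
      _ = (D.δs ^ 2)⁻¹ * I2 ^ 2 := by ring
      _ ≤ (D.δs ^ 2)⁻¹ * ((3 / 2 * D.δs - -(3 / 2 * D.δs)) * J2) :=
          mul_le_mul_of_nonneg_left c2 (by positivity)
      _ = _ := by
          field_simp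
          ring
  have s3 : (discreteRadonFun D F z - radonFun F z) ^ 2
      ≤ 2 * (discreteRadonFun D F z - m) ^ 2 + 2 * (m - radonFun F z) ^ 2 := by
    nlinarith [sq_nonneg ((discreteRadonFun D F z - m) - (m - radonFun F z))]
  calc _ ≤ _ := s3
    _ ≤ 2 * (5 * (D.δx + D.δφ) ^ 2 / D.δs ^ 3 * J1) + 2 * (3 / D.δs * J2) := by linarith
    _ = _ := by ring

end Discretization

/-! ### Operator norm estimate -/

/-- Tonelli: the uniform bound over h makes the nonnegative integrand jointly integrable, after
which the order of integration can be exchanged. -/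
lemma integral_setIntegral_le {α : Type*} [MeasurableSpace α] {μ : Measure α} [SFinite μ]
    {G : α → ℝ → ℝ} (hm : Measurable (Function.uncurry G)) (h0 : ∀ z h, 0 ≤ G z h)
    (hi : ∀ h, Integrable (fun z => G z h) μ) {c K : ℝ} (hc : 0 ≤ c)
    (hK : ∀ h ∈ Icc (-c) c, ∫ z, G z h ∂μ ≤ K) :
    Integrable (fun z => ∫ h in Icc (-c) c, G z h) μ ∧
      ∫ z, (∫ h in Icc (-c) c, G z h) ∂μ ≤ 2 * c * K := by
  have hmi : Measurable fun h => ∫ z, G z h ∂μ :=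
    (hm.stronglyMeasurable.integral_prod_left (μ := μ)).measurable
  have hKi : Integrable (fun h => ∫ z, G z h ∂μ) (volume.restrict (Icc (-c) c)) :=
    Integrable.of_bound hmi.aestronglyMeasurable K
      ((ae_restrict_iff' measurableSet_Icc).2 (ae_of_all _ fun h hh => by
        rw [Real.norm_eq_abs, abs_of_nonneg (integral_nonneg fun z => h0 z h)]
        exact hK h hh))
  have hG : Integrable (Function.uncurry G) (μ.prod (volume.restrict (Icc (-c) c))) := by
    rw [integrable_prod_iff' hm.aestronglyMeasurable]
    refine ⟨ae_of_all _ hi, ?_⟩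
    simpa only [Function.uncurry_apply_pair, Real.norm_eq_abs, abs_of_nonneg (h0 _ _)] using hKi
  refine ⟨hG.integral_prod_left, ?_⟩
  rw [integral_integral_swap hG]
  calc _ ≤ ∫ _h in Icc (-c) c, K :=
        setIntegral_mono_on hKi (integrable_const _) measurableSet_Icc hK
    _ = _ := by
        rw [setIntegral_const, Real.volume_real_Icc_of_le (by linarith), smul_eq_mul]
        ring

lemma boundedOnBall_indicator (g : BoundedContinuousFunction Plane ℝ) :
    BoundedOnBall 1 (Ω.indicator g) where
  measurable := g.continuous.measurable.indicator measurableSet_Ω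
  bounded := ⟨‖g‖, fun x => by
    by_cases hx : x ∈ Ω
    · simpa [hx] using g.norm_coe_le_norm x
    · simp [hx]⟩
  eq_zero x hx := indicator_of_notMem (by simpa [Ω] using hx) _

/-- Nonnegative error bounds may be integrated over the whole cylinder, where shifts of the offset
preserve the measure. -/
lemma restrict_Ω'_le : (volume.restrict Ω' : Measure (ℝ × ℝ)) ≤ cylinderMeasure := by
  rw [cylinderMeasure, Ω', Measure.volume_eq_prod, ← Measure.prod_restrict]
  exact Measure.prod_mono Measure.restrict_le_self le_rfl

lemma measurableSet_Ω' : MeasurableSet Ω' := measurableSet_Ioo.prod measurableSet_Ico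

lemma discreteRadonFun_congr (D : Discretization) {f g : Plane → ℝ}
    (h : f =ᵐ[volume.restrict Ω] g) :
    discreteRadonFun D (Ω.indicator f) = discreteRadonFun D (Ω.indicator g) := by
  have h1 : Ω.indicator f =ᵐ[volume] Ω.indicator g :=
    (ae_eq_restrict_iff_indicator_ae_eq measurableSet_Ω).1 h
  ext z
  have h2 : ∀ i j, D.pixelValue (Ω.indicator f) i j = D.pixelValue (Ω.indicator g) i j :=
    fun i j => by
      rw [Discretization.pixelValue, Discretization.pixelValue,
        integral_congr_ae (ae_restrict_of_ae h1)]
  simp only [discreteRadonFun, h2]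

lemma coeFn_discreteRadon (D : Discretization) (f : L2Image) :
    discreteRadon D f =ᵐ[volume.restrict Ω'] discreteRadonFun D (Ω.indicator f) :=
  MemLp.coeFn_toLp (memLp_discreteRadonFun D f)

lemma norm_sq_eq_integral {α : Type*} [MeasurableSpace α] {μ : Measure α} (f : Lp ℝ 2 μ) :
    ‖f‖ ^ 2 = ∫ x, f x ^ 2 ∂μ := by
  rw [← real_inner_self_eq_norm_sq, L2.inner_def]
  simp [pow_two]

namespace BoundedOnBall

variable {F : Plane → ℝ}

lemma integrable_shift_sq {r : ℝ} (hF : BoundedOnBall r F) (h : ℝ) :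
    Integrable (fun z : ℝ × ℝ => radonFun F (z.1 + h, z.2) ^ 2) cylinderMeasure :=
  (measurePreserving_shift h).integrable_comp_of_integrable hF.integrable_radonFun_sq

lemma integrable_increment_sq {r : ℝ} (hF : BoundedOnBall r F) (h : ℝ) :
    Integrable (fun z : ℝ × ℝ => (radonFun F (z.1 + h, z.2) - radonFun F z) ^ 2)
      cylinderMeasure := by
  have he : ∀ z : ℝ × ℝ, (radonFun F (z.1 + h, z.2) - radonFun F z) ^ 2
      = radonFun F (z.1 + h, z.2) ^ 2 + radonFun F z ^ 2
        - 2 * (radonFun F (z.1 + h, z.2) * radonFun F z) := fun z => by ring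
  simp only [he]
  exact ((hF.integrable_shift_sq h).add hF.integrable_radonFun_sq).sub
    ((hF.integrable_radonFun_mul h).const_mul 2)

lemma setIntegral_sq_discrete_sub_le (hF : BoundedOnBall 1 F) {D : Discretization}
    (hD : D.Compatible) (hη : D.δx + D.δφ ≤ D.δs) :
    ∫ z in Ω', (discreteRadonFun D F z - radonFun F z) ^ 2
      ≤ 1600 * (((D.δx + D.δφ) / D.δs) ^ 2 + D.δs) * ∫ x, F x ^ 2 := by
  have hδ := D.δs_pos
  set E := ∫ x, F x ^ 2 with hE
  have hE0 : 0 ≤ E := integral_nonneg fun x => sq_nonneg _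
  have hEabs : ∫ x, |F x| ^ 2 = E := by simp only [sq_abs, hE]
  obtain ⟨hi1, hb1⟩ := integral_setIntegral_le (μ := cylinderMeasure)
    (G := fun z h => radonFun (fun y => |F y|) (z.1 + h, z.2) ^ 2)
    ((hF.abs.measurable_radonFun.comp (by fun_prop :
      Measurable fun w : (ℝ × ℝ) × ℝ => (w.1.1 + w.2, w.1.2))).pow_const 2)
    (fun _ _ => sq_nonneg _) hF.abs.integrable_shift_sq (c := 5 / 2 * D.δs) (K := 8 * π * E)
    (by positivity) fun h _ => by
      have := hF.abs.integral_radonFun_shift_sq_le zero_le_one h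
      rwa [hEabs, mul_one] at this
  obtain ⟨hi2, hb2⟩ := integral_setIntegral_le (μ := cylinderMeasure)
    (G := fun z h => (radonFun F (z.1 + h, z.2) - radonFun F z) ^ 2)
    (((hF.measurable_radonFun.comp (by fun_prop :
      Measurable fun w : (ℝ × ℝ) × ℝ => (w.1.1 + w.2, w.1.2))).sub
        (hF.measurable_radonFun.comp measurable_fst)).pow_const 2)
    (fun _ _ => sq_nonneg _) hF.integrable_increment_sq (c := 3 / 2 * D.δs)
    (K := 16 * π * (3 / 2 * D.δs) * E)
    (by positivity) fun h hh => by
      refine (hF.integral_radonFun_increment_sq_le h).trans ?_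
      have := abs_le.2 hh
      gcongr
  set g1 : ℝ × ℝ → ℝ := fun z => ∫ h in Icc (-(5 / 2 * D.δs)) (5 / 2 * D.δs),
    radonFun (fun y => |F y|) (z.1 + h, z.2) ^ 2 with hg1
  set g2 : ℝ × ℝ → ℝ := fun z => ∫ h in Icc (-(3 / 2 * D.δs)) (3 / 2 * D.δs),
    (radonFun F (z.1 + h, z.2) - radonFun F z) ^ 2 with hg2
  have hg10 : ∀ z, 0 ≤ g1 z := fun z => integral_nonneg fun _ => sq_nonneg _
  have hg20 : ∀ z, 0 ≤ g2 z := fun z => integral_nonneg fun _ => sq_nonneg _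
  have hη0 : 0 ≤ D.δx + D.δφ := add_nonneg D.δx_pos.le D.δφ_nonneg
  have hi : Integrable (fun z => 10 * (D.δx + D.δφ) ^ 2 / D.δs ^ 3 * g1 z + 6 / D.δs * g2 z)
      cylinderMeasure := (hi1.const_mul _).add (hi2.const_mul _)
  calc ∫ z in Ω', (discreteRadonFun D F z - radonFun F z) ^ 2
      ≤ ∫ z in Ω', (10 * (D.δx + D.δφ) ^ 2 / D.δs ^ 3 * g1 z + 6 / D.δs * g2 z) :=
        integral_mono_of_nonneg (ae_of_all _ fun z => sq_nonneg _)
          (hi.mono_measure restrict_Ω'_le) ((ae_restrict_iff' measurableSet_Ω').2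
            (ae_of_all _ fun z hz =>
              Discretization.sq_discreteRadonFun_sub_radonFun_le hD hη hF hz))
    _ ≤ ∫ z, (10 * (D.δx + D.δφ) ^ 2 / D.δs ^ 3 * g1 z + 6 / D.δs * g2 z) ∂cylinderMeasure :=
        integral_mono_measure restrict_Ω'_le (ae_of_all _ fun z => add_nonneg
          (mul_nonneg (by positivity) (hg10 z)) (mul_nonneg (by positivity) (hg20 z))) hi
    _ = 10 * (D.δx + D.δφ) ^ 2 / D.δs ^ 3 * (∫ z, g1 z ∂cylinderMeasure)
        + 6 / D.δs * ∫ z, g2 z ∂cylinderMeasure := by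
        rw [integral_add (hi1.const_mul _) (hi2.const_mul _), integral_const_mul,
          integral_const_mul]
    _ ≤ 10 * (D.δx + D.δφ) ^ 2 / D.δs ^ 3 * (2 * (5 / 2 * D.δs) * (8 * π * E))
        + 6 / D.δs * (2 * (3 / 2 * D.δs) * (16 * π * (3 / 2 * D.δs) * E)) := by
        gcongr
    -- 400 = 10 · 5 · 8 and 432 = 6 · 3 · 24; both multiples of π lie below 1600.
    _ = (400 * π * ((D.δx + D.δφ) / D.δs) ^ 2 + 432 * π * D.δs) * E := by
        field_simp
        ring
    _ ≤ _ := by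
        refine mul_le_mul_of_nonneg_right ?_ hE0
        have hπ := Real.pi_lt_d2
        have h1 : 0 ≤ ((D.δx + D.δφ) / D.δs) ^ 2 := by positivity
        nlinarith

end BoundedOnBall

lemma norm_discreteRadon_sub_radon_toLp_le {D : Discretization} (hD : D.Compatible)
    (hη : D.δx + D.δφ ≤ D.δs) (g : BoundedContinuousFunction Plane ℝ) :
    ‖(discreteRadon D - radon) (BoundedContinuousFunction.toLp 2 (volume.restrict Ω) ℝ g)‖ ^ 2
      ≤ 1600 * (((D.δx + D.δφ) / D.δs) ^ 2 + D.δs)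
        * ‖BoundedContinuousFunction.toLp 2 (volume.restrict Ω) ℝ g‖ ^ 2 := by
  set f : L2Image := BoundedContinuousFunction.toLp 2 (volume.restrict Ω) ℝ g
  have hfg : f =ᵐ[volume.restrict Ω] g := BoundedContinuousFunction.coeFn_toLp _ _ _ g
  have h1 : ‖(discreteRadon D - radon) f‖ ^ 2 = ∫ z in Ω',
      (discreteRadonFun D (Ω.indicator g) z - radonFun (Ω.indicator g) z) ^ 2 := by
    rw [norm_sq_eq_integral]
    refine integral_congr_ae ?_
    rw [_root_.sub_apply]
    filter_upwards [Lp.coeFn_sub (discreteRadon D f) (radon f), coeFn_discreteRadon D f,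
      coeFn_radon f, radonFun_congr hfg] with z e1 e2 e3 e4
    rw [e1, Pi.sub_apply, e2, e3, e4, discreteRadonFun_congr D hfg]
  have h2 : ‖f‖ ^ 2 = ∫ x, Ω.indicator g x ^ 2 := by
    rw [norm_sq_eq_integral, ← integral_indicator measurableSet_Ω]
    refine integral_congr_ae ?_
    filter_upwards [(ae_eq_restrict_iff_indicator_ae_eq measurableSet_Ω).1 hfg] with x hx
    rw [← hx]
    by_cases hxΩ : x ∈ Ω <;> simp [hxΩ]
  rw [h1, h2]
  exact (boundedOnBall_indicator g).setIntegral_sq_discrete_sub_le hD hη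

theorem norm_discreteRadon_sub_radon_le {D : Discretization} (hD : D.Compatible)
    (hη : D.δx + D.δφ ≤ D.δs) :
    ‖discreteRadon D - radon‖ ≤ 40 * ((D.δx + D.δφ) / D.δs + √D.δs) := by
  have hδ := D.δs_pos
  have hη0 : 0 ≤ D.δx + D.δφ := add_nonneg D.δx_pos.le D.δφ_nonneg
  refine ContinuousLinearMap.opNorm_le_bound _ (by positivity) fun f => ?_
  -- Both sides are continuous in f, so the inequality passes from the dense class of bounded
  -- continuous functions to all of L².
  refine (BoundedContinuousFunction.toLp_denseRange ℝ (volume.restrict Ω : Measure Plane) ℝ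
    (p := 2) (by norm_num)).induction_on
    (p := fun f => ‖(discreteRadon D - radon) f‖ ≤ 40 * ((D.δx + D.δφ) / D.δs + √D.δs) * ‖f‖) f
    (isClosed_le (by fun_prop) (by fun_prop)) fun g => ?_
  refine (sq_le_sq₀ (norm_nonneg _) (by positivity)).1 ?_
  refine (norm_discreteRadon_sub_radon_toLp_le hD hη g).trans ?_
  rw [mul_pow]
  refine mul_le_mul_of_nonneg_right ?_ (sq_nonneg _)
  -- The cross term in the square; dropping it gives a² + δs ≤ (a + √δs)², and 1600 = 40².
  have h1 : 0 ≤ (D.δx + D.δφ) / D.δs * √D.δs := by positivity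
  nlinarith [Real.sq_sqrt hδ.le]

end PixelRadon

/-! ### Convergence and rate along a filter -/

theorem theorem2p6 {ι : Type*} (l : Filter ι) (D : ι → PixelRadon.Discretization)
    (hD : ∀ i, (D i).Compatible)
    (hδs : Filter.Tendsto (fun i => (D i).δs) l (nhds 0)) :
    (Filter.Tendsto (fun i => (D i).δφ / (D i).δs) l (nhds 0) →
      Filter.Tendsto (fun i => (D i).δx / (D i).δs) l (nhds 0) →
      Filter.Tendsto (fun i => ‖PixelRadon.discreteRadon (D i) - PixelRadon.radon‖) l (nhds 0)) ∧
    (∀ ε : ℝ, 0 < ε → ε ≤ 1 / 2 →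
      (fun i => (D i).δφ) =O[l] (fun i => (D i).δs ^ (1 + ε)) →
      (fun i => (D i).δx) =O[l] (fun i => (D i).δs ^ (1 + ε)) →
      (fun i => ‖PixelRadon.discreteRadon (D i) - PixelRadon.radon‖) =O[l]
        (fun i => (D i).δs ^ ε)) := by
  have key : ∀ i, ((D i).δx + (D i).δφ) / (D i).δs ≤ 1 →
      ‖PixelRadon.discreteRadon (D i) - PixelRadon.radon‖
        ≤ 40 * (((D i).δx + (D i).δφ) / (D i).δs + √(D i).δs) := fun i hi =>
    PixelRadon.norm_discreteRadon_sub_radon_le (hD i) ((div_le_one (D i).δs_pos).1 hi)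
  refine ⟨fun hφ hx => ?_, fun ε hε hε2 hφ hx => ?_⟩
  · have hη : Filter.Tendsto (fun i => ((D i).δx + (D i).δφ) / (D i).δs) l (nhds 0) := by
      simpa only [add_div, add_zero] using hx.add hφ
    have hsq : Filter.Tendsto (fun i => √(D i).δs) l (nhds 0) := by
      simpa [Function.comp_def] using (Real.continuous_sqrt.tendsto 0).comp hδs
    have hlim : Filter.Tendsto
        (fun i => 40 * (((D i).δx + (D i).δφ) / (D i).δs + √(D i).δs)) l (nhds 0) := by
      simpa using (hη.add hsq).const_mul 40
    refine squeeze_zero' (Filter.Eventually.of_forall fun i => norm_nonneg _) ?_ hlim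
    filter_upwards [hη.eventually_le_const zero_lt_one] with i hi using key i hi
  · obtain ⟨C, hC⟩ := (hx.add hφ).bound
    have hpow : Filter.Tendsto (fun i => (D i).δs ^ ε) l (nhds 0) := by
      simpa [hε.ne'] using hδs.rpow_const (Or.inr hε.le)
    have hCpow : Filter.Tendsto (fun i => C * (D i).δs ^ ε) l (nhds 0) := by
      simpa using hpow.const_mul C
    -- C accounts for the mesh ratio (δx+δφ)/δs, and 1 for √δs.
    refine Asymptotics.IsBigO.of_bound (40 * (C + 1)) ?_
    filter_upwards [hC, hCpow.eventually_le_const zero_lt_one, hδs.eventually_le_const zero_lt_one]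
      with i h1 h2 h3
    have hδ := (D i).δs_pos
    have hη : ((D i).δx + (D i).δφ) / (D i).δs ≤ C * (D i).δs ^ ε := by
      rw [div_le_iff₀ hδ]
      rw [Real.norm_eq_abs, Real.norm_eq_abs, abs_of_pos (Real.rpow_pos_of_pos hδ _),
        Real.rpow_add hδ, Real.rpow_one] at h1
      calc _ ≤ _ := le_abs_self _
        _ ≤ _ := h1
        _ = _ := by ring
    -- Here ε ≤ 1/2 enters, for δs ≤ 1: the regularity of RF limits the rate to δs^(1/2).
    have hs : √(D i).δs ≤ (D i).δs ^ ε := by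
      rw [Real.sqrt_eq_rpow]
      exact Real.rpow_le_rpow_of_exponent_ge hδ h3 hε2
    rw [norm_norm, Real.norm_eq_abs, abs_of_pos (Real.rpow_pos_of_pos hδ _)]
    refine (key i (hη.trans h2)).trans ?_
    linarith
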